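/- There is an absolute constant $K$ with the following property. Let $X=(X_v)_{v\in V}$ be a non-empty finite family of variables, each with a non-empty finite state space of at most $r$ values ($r=2$ for binary variables), let $\mathcal G_P$ and $\mathcal G_Q$ be chordal graphs on $V$, and let $Y,Z\subseteq V$ be disjoint. A \emph{decomposable model} over a chordal graph $\mathcal G$ is a strictly positive Markov network whose factors are conditional probability tables $P^{\mathcal T}_C$ on the maximal cliques $C$ of $\mathcal G$ along a rooted clique tree of $\mathcal G$: the table of the root is a probability distribution, the table of any other clique $C$ with parent $D$ is a conditional distribution of $X_{C\setminus D}$ given $X_{C\cap D}$, and the joint distribution is $P(x)=\prod_C P^{\mathcal T}_C(x_C)$. An \emph{$\mathcal N$-partition} $\mathcal N_{P,Z}$ of $\mathcal G_P$ is a set of subsets $N\subseteq V$ such that the sets of maximal cliques of the induced subgraphs $\mathcal G_P(N)$ partition the set of maximal cliques of $\mathcal G_P$, and every $v\in V\setminus Z$ lies in exactly one $N$; similarly $\mathcal N_{Q,Z}$. Let $\kappa(\mathcal N)$ be the graph on $V$ in which two distinct vertices are adjacent iff some $N\in\mathcal N$ contains both, let $\mathcal H=\mathcal U(\kappa(\mathcal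 N_{P,Z}),\kappa(\mathcal N_{Q,Z}))$ be any chordal graph on $V$ that contains $\kappa(\mathcal N_{P,Z})$ and $\kappa(\mathcal N_{Q,Z})$, and let $\omega(\mathcal H)$ be its treewidth (the size of its largest clique minus one). For real $\alpha,\beta$ of which exactly one is zero, let $$d^{(\alpha,0)}(p,q)=\tfrac1{\alpha^2}\Bigl(p^\alpha\log\tfrac{p^\alpha}{q^\alpha}-p^\alpha+q^\alpha\Bigr),\qquad d^{(0,\beta)}(p,q)=\tfrac1{\beta^2}\Bigl(q^\beta\log\tfrac{q^\beta}{p^\beta}-q^\beta+p^\beta\Bigr)$$ and let the conditional $\alpha\beta$-divergence be $$D_{AB}^{(\alpha,\beta)}(P_{Y\mid Z}\,\|\,Q_{Y\mid Z})=\sum_{z}P_Z(z)\sum_{y}d^{(\alpha,\beta)}\bigl(P_{Y\mid z}(y),Q_{Y\mid z}(y)\bigr).$$ Then there is a straight-line real-arithmetic program, that is, a finite sequence of unit-cost instructions $+,-,\times,/$, $\log$, power and rational constant (with the convention $x/0=0$), which makes at most $$K\cdot|V|\cdot r^{\,\omega(\mathcal H)+1}$$ steps (so $O(|X|\cdot 2^{\omega(\mathcal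 H)+1})$ for binary variables) and which, for all real $\alpha,\beta$ of which exactly one is zero and all decomposable models $P$ over $\mathcal G_P$ and $Q$ over $\mathcal G_Q$, outputs $D_{AB}^{(\alpha,\beta)}(P_{Y\mid Z}\,\|\,Q_{Y\mid Z})$ on the input consisting of $\alpha$, $\beta$ and the entries of the conditional probability tables of $P$ and $Q$. The program may depend on the graphs, the sets and the state spaces, but not on $\alpha$, $\beta$ or the numerical entries of the models. -/

import Mathlib

namespace DMDiv

/-! ### Configurations, marginals, conditionals -/

/-- The joint state space of the variables in `A`. -/
abbrev Config {V : Type*} (S : V → Type*) (A : Finset V) : Type _ := (v : A) → S v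

section Probability

variable {V : Type*} [Fintype V] [DecidableEq V] {S : V → Type*} [∀ v, Fintype (S v)]

open Classical in
/-- The marginal `p_A` of `p`, obtained by summing out all variables outside `A`. -/
noncomputable def marginal (p : (∀ v, S v) → ℝ) (A : Finset V) (a : Config S A) : ℝ :=
  ∑ x : ∀ v, S v with A.restrict x = a, p x

open Classical in
/-- The conditional probability `p_{Y | z}(y)`: the joint marginal of `Y = y`, `Z = z`
divided by the marginal of `Z = z`. -/
noncomputable def conditional (p : (∀ v, S v) → ℝ) (Y Z : Finset V)
    (z : Config S Z) (y : Config S Y) : ℝ :=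
  (∑ x : ∀ v, S v with Y.restrict x = y ∧ Z.restrict x = z, p x) / marginal p Z z

end Probability

/-! ### The alpha-beta divergence -/

open Classical in
/-- The pointwise alpha-beta divergence. -/
noncomputable def abTerm (α β p q : ℝ) : ℝ :=
  if α ≠ 0 ∧ β ≠ 0 ∧ α + β ≠ 0 then
    -1 / (α * β) *
      (p ^ α * q ^ β - α * p ^ (α + β) / (α + β) - β * q ^ (α + β) / (α + β))
  else if α ≠ 0 ∧ β = 0 then
    1 / α ^ 2 * (p ^ α * Real.log (p ^ α / q ^ α) - p ^ α + q ^ α)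
  else if α ≠ 0 ∧ α = -β then
    1 / α ^ 2 * (Real.log (q ^ α / p ^ α) + (q ^ α / p ^ α)⁻¹ - 1)
  else if α = 0 ∧ β ≠ 0 then
    1 / β ^ 2 * (q ^ β * Real.log (q ^ β / p ^ β) - q ^ β + p ^ β)
  else
    1 / 2 * (Real.log p - Real.log q) ^ 2

/-- The alpha-beta divergence between two positive measures on a finite set. -/
noncomputable def abDiv {Ω : Type*} [Fintype Ω] (α β : ℝ) (p q : Ω → ℝ) : ℝ :=
  ∑ x, abTerm α β (p x) (q x)

/-- The conditional alpha-beta divergence: the expectation under `p_Z` of the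
divergence between `p_{Y | z}` and `q_{Y | z}`. -/
noncomputable def condABDiv {V : Type*} [Fintype V] [DecidableEq V] {S : V → Type*}
    [∀ v, Fintype (S v)] (α β : ℝ) (p q : (∀ v, S v) → ℝ) (Y Z : Finset V) : ℝ :=
  ∑ z : Config S Z,
    marginal p Z z * abDiv α β (conditional p Y Z z) (conditional q Y Z z)

/-! ### Chordal graphs, cliques, partitions -/

/-- A graph is chordal if every cycle of length at least four has a chord. -/
def IsChordal {V : Type*} (G : SimpleGraph V) : Prop :=
  ∀ (u : V) (c : G.Walk u u), c.IsCycle → 4 ≤ c.length →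
    ∃ a ∈ c.support, ∃ b ∈ c.support, G.Adj a b ∧ s(a, b) ∉ c.edges

open Classical in
/-- The maximal cliques of the subgraph of `G` induced by the vertex set `N`. -/
noncomputable def maxCliquesIn {V : Type*} (G : SimpleGraph V) (N : Finset V) :
    Finset (Finset V) :=
  {C ∈ N.powerset | Maximal (fun D : Finset V => D ⊆ N ∧ G.IsClique (D : Set V)) C}

/-- The maximal cliques of `G`. -/
noncomputable abbrev maxCliques {V : Type*} [Fintype V] (G : SimpleGraph V) :
    Finset (Finset V) :=
  maxCliquesIn G Finset.univ

/-- The treewidth of a chordal graph: the size of its largest clique minus one. -/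
noncomputable def chordalTreewidth {V : Type*} (H : SimpleGraph V) : ℕ := H.cliqueNum - 1

/-- `𝒩` is an `N`-partition of `G` for the marginal variables `Z`: the maximal cliques of the
subgraphs induced by the members of `𝒩` partition the maximal cliques of `G`, and the members
of `𝒩` partition the variables outside `Z`. -/
structure IsNPartition {V : Type*} [Fintype V] (G : SimpleGraph V) (Z : Finset V)
    (𝒩 : Finset (Finset V)) : Prop where
  subset_cliques : ∀ N ∈ 𝒩, maxCliquesIn G N ⊆ maxCliques G
  cliques_partition : ∀ C ∈ maxCliques G, ∃! N, N ∈ 𝒩 ∧ C ∈ maxCliquesIn G N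
  compl_partition : ∀ v ∉ Z, ∃! N, N ∈ 𝒩 ∧ v ∈ N

/-- The graph `κ(𝒩)` in which every member of `𝒩` is turned into a clique. -/
def setsToCliques {V : Type*} (𝒩 : Finset (Finset V)) : SimpleGraph V where
  Adj u v := u ≠ v ∧ ∃ N ∈ 𝒩, u ∈ N ∧ v ∈ N
  symm := ⟨fun _ _ h => ⟨h.1.symm, by obtain ⟨N, hN, hu, hv⟩ := h.2; exact ⟨N, hN, hv, hu⟩⟩⟩
  loopless := ⟨fun _ h => h.1 rfl⟩

/-- `H` is a computation graph `𝒰(G₁, G₂)`: a chordal graph containing `G₁` and `G₂`. -/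
structure IsComputationGraph {V : Type*} (H G₁ G₂ : SimpleGraph V) : Prop where
  chordal : IsChordal H
  left_le : G₁ ≤ H
  right_le : G₂ ≤ H

/-! ### Decomposable models -/

open Classical in
/-- A decomposable model over the chordal graph `G`: a strictly positive Markov network whose
factors are the conditional probability tables of the maximal cliques along a rooted clique
tree of `G`. The table of the root is a distribution; the table of any other clique `C` with
parent `D` is a conditional distribution of the variables in `C \ D` given those in `C ∩ D`. -/
structure DecomposableModel {V : Type*} [Fintype V] [DecidableEq V] (G : SimpleGraph V)
    (S : V → Type*) [∀ v, Fintype (S v)] where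
  /-- the clique tree -/
  tree : SimpleGraph (maxCliques G)
  isTree : tree.IsTree
  /-- the cliques that contain a given vertex form a subtree -/
  running_intersection : ∀ v : V, (tree.induce {C | v ∈ C.1}).Preconnected
  root : maxCliques G
  /-- the conditional probability tables -/
  cpt : (C : maxCliques G) → Config S C.1 → ℝ
  cpt_pos : ∀ C x, 0 < cpt C x
  cpt_root : ∑ x, cpt root x = 1
  cpt_cond : ∀ C D, tree.Adj C D → tree.dist root D < tree.dist root C →
    ∀ x₀ : Config S C.1,
      ∑ x : Config S C.1 with ∀ v : C.1, v.1 ∈ D.1 → x v = x₀ v, cpt C x = 1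

/-- The joint distribution of a decomposable model: the product of its tables. -/
noncomputable def DecomposableModel.joint {V : Type*} [Fintype V] [DecidableEq V]
    {G : SimpleGraph V} {S : V → Type*} [∀ v, Fintype (S v)] (M : DecomposableModel G S)
    (x : ∀ v, S v) : ℝ :=
  ∏ C : maxCliques G, M.cpt C (C.1.restrict x)

/-! ### The machine model: straight-line programs over the reals

A program is a list of instructions without branching or looping. Every instruction performs
one real operation on inputs or on previously computed values, at unit cost, so the running
time of a program is its length. Only rational constants can be written into a program. -/

/-- Where an instruction reads an argument: an input cell, or the value computed by the
`k`-th instruction. -/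
inductive Operand (ι : Type*) where
  | input (i : ι)
  | reg (k : ℕ)

/-- The instructions. -/
inductive Instr (ι : Type*) where
  | const (c : ℚ)
  | add (a b : Operand ι)
  | sub (a b : Operand ι)
  | mul (a b : Operand ι)
  | div (a b : Operand ι)
  | log (a : Operand ι)
  | pow (a b : Operand ι)

/-- The value of an operand, given the inputs and the values computed so far. -/
def Operand.value {ι : Type*} (inp : ι → ℝ) (mem : List ℝ) : Operand ι → ℝ
  | .input i => inp i
  | .reg k => mem.getD k 0

/-- The value computed by one instruction. -/
noncomputable def Instr.value {ι : Type*} (inp : ι → ℝ) (mem : List ℝ) : Instr ι → ℝ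
  | .const c => (c : ℝ)
  | .add a b => a.value inp mem + b.value inp mem
  | .sub a b => a.value inp mem - b.value inp mem
  | .mul a b => a.value inp mem * b.value inp mem
  | .div a b => a.value inp mem / b.value inp mem
  | .log a => Real.log (a.value inp mem)
  | .pow a b => (a.value inp mem) ^ (b.value inp mem)

/-- A straight-line program with input cells indexed by `ι`. -/
abbrev Program (ι : Type*) : Type _ := List (Instr ι)

/-- The number of steps of a run: one for every instruction. -/
def Program.steps {ι : Type*} (prog : Program ι) : ℕ := prog.length

/-- The list of all values computed by a program, in order. -/
noncomputable def Program.run {ι : Type*} (prog : Program ι) (inp : ι → ℝ) : List ℝ :=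
  prog.foldl (fun mem i => mem ++ [i.value inp mem]) []

/-- The output of a program: the value of its last instruction. -/
noncomputable def Program.output {ι : Type*} (prog : Program ι) (inp : ι → ℝ) : ℝ :=
  (prog.run inp).getLastD 0

/-- The input cells: the two parameters of the divergence, and one cell for every entry of
every conditional probability table of the two models. -/
inductive InputCell {V : Type*} [Fintype V] (GP GQ : SimpleGraph V) (S : V → Type*) where
  | alpha
  | beta
  | cptP (C : maxCliques GP) (x : Config S C.1)
  | cptQ (C : maxCliques GQ) (x : Config S C.1)

/-- The contents of the input cells for the parameters `α`, `β` and the models `P`, `Q`. -/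
def inputs {V : Type*} [Fintype V] [DecidableEq V] {GP GQ : SimpleGraph V} {S : V → Type*}
    [∀ v, Fintype (S v)] (α β : ℝ) (P : DecomposableModel GP S) (Q : DecomposableModel GQ S) :
    InputCell GP GQ S → ℝ
  | .alpha => α
  | .beta => β
  | .cptP C x => P.cpt C x
  | .cptQ C x => Q.cpt C x

end DMDiv

open DMDiv

/-!
The divergence is a sum over the configurations of `Y ∪ Z` of the marginal `P_Z` times a function
of the two conditional probabilities `p = P(y | z)` and `q = Q(y | z)`. The argument rests on three
facts.

*The conditional probabilities factorize along the partitions.* The joint distribution of a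
decomposable model is the product over `N ∈ 𝒩` of the potentials `φ_N`, the products of the tables
of the maximal cliques in `N`. A variable outside `Z` occurs in only one `N`, so variables outside
`Z` can be summed out in each potential separately (`sumOut_prod`,
`DecomposableModel.sumOut_joint`). Hence `P_Z` is a product of functions of `x_N`, and so are `p`,
`p ^ γ` and the same expressions for `q`, while `log (p ^ γ)` and `log (q ^ γ)` are sums of such
functions.

*Sums of a product times a sum are sums of products over the dual numbers.* With `γ = α + β` the
divergence is a fixed expression in `α`, `β` and the four sums of `P_Z p ^ γ`, `P_Z q ^ γ`,
`P_Z p ^ γ L` and `P_Z q ^ γ L`, where `L = log (p ^ γ) - log (q ^ γ)` (`abTerm_eq`,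
`condABDiv_eq_dualSum`). Since `∏ a_i (1 + l_i ε) = ∏ a_i + (∏ a_i) (∑ l_i) ε`, they are the
components of two sums of products of local factors with values in `ℝ[ε]` (`prod_weighted`).

*Such sums are computed by variable elimination.* Every `N` is a clique of the computation graph
`H`. By Dirac's theorem (`IsChordal.exists_isSimplicialIn`) every non-empty induced subgraph of `H`
has a simplicial vertex. Eliminating it only involves tables on cliques of `H`, which have at most
`r ^ (ω(H) + 1)` entries, so the total cost is linear in the number of factors and variables
(`IsChordal.cost_sumOut_prod`). Chordality of the two model graphs bounds the number of maximal
cliques, and thereby the number of factors, by `|V| + 1` (`IsChordal.card_maxCliquesIn_le`).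

Programs are handled through the relation `Cost`, which bounds the number of instructions needed to
obtain a set of quantities from another one. The clique trees of the models play no role for the
program: only the product form of the joint distribution and the positivity of the tables enter.
-/

namespace DMDiv

/-! ### Straight-line cost calculus -/

section Cost

variable {ι θ κ : Type*}

theorem Program.run_concat (prog : Program ι) (i : Instr ι) (inp : ι → ℝ) :
    Program.run (prog ++ [i]) inp = prog.run inp ++ [i.value inp (prog.run inp)] := by
  simp [Program.run]

theorem Program.length_run (prog : Program ι) (inp : ι → ℝ) :
    (prog.run inp).length = prog.length := by
  induction prog using List.reverseRecOn with
  | nil => rfl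
  | append_singleton p i ih => rw [run_concat, List.length_append, ih]; simp

theorem Program.run_prefix (prog q : Program ι) (inp : ι → ℝ) :
    prog.run inp <+: Program.run (prog ++ q) inp := by
  induction q using List.reverseRecOn with
  | nil => simp
  | append_singleton q i ih =>
    rw [← List.append_assoc, run_concat]
    exact ih.trans (List.prefix_append _ _)

/-- The quantity `f`, a function of the parameter `t` that determines the inputs, can be read
off from some fixed operand once `prog` has been run, and however `prog` is continued. -/
def Avail (inp : θ → ι → ℝ) (prog : Program ι) (f : θ → ℝ) : Prop :=
  ∃ o : Operand ι, ∀ (q : Program ι) (t : θ),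
    o.value (inp t) (Program.run (prog ++ q) (inp t)) = f t

/-- Whenever the quantities in `A` are available, `n` further instructions suffice to make those
in `B` available too. -/
def Cost (inp : θ → ι → ℝ) (A : Set (θ → ℝ)) (n : ℕ) (B : Set (θ → ℝ)) : Prop :=
  ∀ prog : Program ι, (∀ f ∈ A, Avail inp prog f) →
    ∃ q : Program ι, q.length ≤ n ∧ ∀ f ∈ B, Avail inp (prog ++ q) f

variable {inp : θ → ι → ℝ} {A A' B B' C : Set (θ → ℝ)} {n m n' : ℕ} {f g : θ → ℝ}

theorem Avail.append {prog : Program ι} (h : Avail inp prog f) (q : Program ι) :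
    Avail inp (prog ++ q) f := by
  obtain ⟨o, ho⟩ := h
  exact ⟨o, fun q' t => by rw [List.append_assoc]; exact ho _ t⟩

theorem Avail.concat {prog : Program ι} (i : Instr ι)
    (h : ∀ t, i.value (inp t) (prog.run (inp t)) = f t) : Avail inp (prog ++ [i]) f := by
  refine ⟨.reg prog.length, fun q t => ?_⟩
  obtain ⟨l, hl⟩ := Program.run_prefix (prog ++ [i]) q (inp t)
  rw [← hl, Program.run_concat, h t]
  simp [Operand.value, List.getD_eq_getElem?_getD, ← Program.length_run prog (inp t)]

theorem Cost.mono (h : Cost inp A n B) (hA : A ⊆ A') (hn : n ≤ n') (hB : B' ⊆ B) :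
    Cost inp A' n' B' := fun prog hp => by
  obtain ⟨q, hq, hav⟩ := h prog fun f hf => hp f (hA hf)
  exact ⟨q, hq.trans hn, fun f hf => hav f (hB hf)⟩

theorem Cost.of_subset (h : B ⊆ A) : Cost inp A n B := fun _ hp =>
  ⟨[], Nat.zero_le _, fun f hf => (hp f (h hf)).append _⟩

theorem Cost.of_mem (h : f ∈ A) : Cost inp A 0 {f} :=
  .of_subset (Set.singleton_subset_iff.2 h)

theorem Cost.trans (h₁ : Cost inp A n B) (h₂ : Cost inp (A ∪ B) m C) :
    Cost inp A (n + m) (B ∪ C) := fun prog hp => by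
  obtain ⟨q, hq, hav⟩ := h₁ prog hp
  obtain ⟨q', hq', hav'⟩ := h₂ (prog ++ q) <| by
    rintro f (hf | hf)
    exacts [(hp f hf).append _, hav f hf]
  refine ⟨q ++ q', by simp; omega, ?_⟩
  rw [← List.append_assoc]
  rintro f (hf | hf)
  exacts [(hav f hf).append _, hav' f hf]

theorem Cost.union (h₁ : Cost inp A n B) (h₂ : Cost inp A m C) : Cost inp A (n + m) (B ∪ C) :=
  h₁.trans (h₂.mono Set.subset_union_left le_rfl subset_rfl)

theorem Cost.biUnion (s : Finset κ) (c : κ → ℕ) (D : κ → Set (θ → ℝ))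
    (h : ∀ i ∈ s, Cost inp A (c i) (D i)) : Cost inp A (∑ i ∈ s, c i) (⋃ i ∈ s, D i) := by
  classical
  induction s using Finset.induction_on with
  | empty => exact .of_subset (by simp)
  | insert a s ha ih =>
    rw [Finset.sum_insert ha, Finset.set_biUnion_insert]
    exact (h a (by simp)).union (ih fun i hi => h i (by simp [hi]))

theorem Cost.const (c : ℚ) : Cost inp A 1 {fun _ => (c : ℝ)} := fun _ _ =>
  ⟨[.const c], le_rfl, by rintro f rfl; exact Avail.concat _ fun _ => rfl⟩

theorem Cost.unary (mk : Operand ι → Instr ι) (op : ℝ → ℝ)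
    (hmk : ∀ a inp mem, (mk a).value inp mem = op (a.value inp mem))
    (hf : Cost inp A n {f}) : Cost inp A (n + 1) {fun t => op (f t)} := fun prog hp => by
  obtain ⟨q, hq, hav⟩ := hf prog hp
  obtain ⟨a, ha⟩ := hav f rfl
  refine ⟨q ++ [mk a], by simpa using hq, ?_⟩
  rintro _ rfl
  rw [← List.append_assoc]
  refine Avail.concat _ fun t => ?_
  have h := ha [] t
  rw [List.append_nil] at h
  rw [hmk, h]

theorem Cost.binary (mk : Operand ι → Operand ι → Instr ι) (op : ℝ → ℝ → ℝ)
    (hmk : ∀ a b inp mem, (mk a b).value inp mem = op (a.value inp mem) (b.value inp mem))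
    (hf : Cost inp A n {f}) (hg : Cost inp A m {g}) :
    Cost inp A (n + m + 1) {fun t => op (f t) (g t)} := fun prog hp => by
  obtain ⟨q, hq, hav⟩ := hf.union hg prog hp
  obtain ⟨a, ha⟩ := hav f (by simp)
  obtain ⟨b, hb⟩ := hav g (by simp)
  refine ⟨q ++ [mk a b], by simpa using hq, ?_⟩
  rintro _ rfl
  rw [← List.append_assoc]
  refine Avail.concat _ fun t => ?_
  have h := ha [] t
  have h' := hb [] t
  rw [List.append_nil] at h h'
  rw [hmk, h, h']

theorem Cost.add (hf : Cost inp A n {f}) (hg : Cost inp A m {g}) :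
    Cost inp A (n + m + 1) {fun t => f t + g t} := .binary .add _ (fun _ _ _ _ => rfl) hf hg

theorem Cost.sub (hf : Cost inp A n {f}) (hg : Cost inp A m {g}) :
    Cost inp A (n + m + 1) {fun t => f t - g t} := .binary .sub _ (fun _ _ _ _ => rfl) hf hg

theorem Cost.mul (hf : Cost inp A n {f}) (hg : Cost inp A m {g}) :
    Cost inp A (n + m + 1) {fun t => f t * g t} := .binary .mul _ (fun _ _ _ _ => rfl) hf hg

theorem Cost.div (hf : Cost inp A n {f}) (hg : Cost inp A m {g}) :
    Cost inp A (n + m + 1) {fun t => f t / g t} := .binary .div _ (fun _ _ _ _ => rfl) hf hg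

theorem Cost.pow (hf : Cost inp A n {f}) (hg : Cost inp A m {g}) :
    Cost inp A (n + m + 1) {fun t => f t ^ g t} := .binary .pow _ (fun _ _ _ _ => rfl) hf hg

theorem Cost.log (hf : Cost inp A n {f}) : Cost inp A (n + 1) {fun t => Real.log (f t)} :=
  .unary .log _ (fun _ _ _ => rfl) hf

theorem Cost.neg (hf : Cost inp A n {f}) : Cost inp A (n + 2) {fun t => -f t} :=
  ((Cost.const 0).sub hf).mono subset_rfl (by omega) (by simp)

theorem Cost.sum (s : Finset κ) (F : κ → θ → ℝ) (h : ∀ i ∈ s, Cost inp A n {F i}) :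
    Cost inp A ((n + 1) * s.card + 1) {fun t => ∑ i ∈ s, F i t} := by
  classical
  induction s using Finset.induction_on with
  | empty => simpa using Cost.const (inp := inp) (A := A) 0
  | insert a s ha ih =>
    simp only [Finset.sum_insert ha, Finset.card_insert_of_notMem ha]
    exact ((h a (by simp)).add (ih fun i hi => h i (by simp [hi]))).mono subset_rfl
      (by ring_nf; omega) subset_rfl

theorem Cost.prod (s : Finset κ) (F : κ → θ → ℝ) (h : ∀ i ∈ s, Cost inp A n {F i}) :
    Cost inp A ((n + 1) * s.card + 1) {fun t => ∏ i ∈ s, F i t} := by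
  classical
  induction s using Finset.induction_on with
  | empty => simpa using Cost.const (inp := inp) (A := A) 1
  | insert a s ha ih =>
    simp only [Finset.prod_insert ha, Finset.card_insert_of_notMem ha]
    exact ((h a (by simp)).mul (ih fun i hi => h i (by simp [hi]))).mono subset_rfl
      (by ring_nf; omega) subset_rfl

/-- The two real quantities that make up a quantity with values in the dual numbers. -/
def components (d : θ → DualNumber ℝ) : Set (θ → ℝ) :=
  {fun t => (d t).fst, fun t => (d t).snd}

theorem Cost.components_intro {d : θ → DualNumber ℝ} (h₁ : Cost inp A n {fun t => (d t).fst})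
    (h₂ : Cost inp A m {fun t => (d t).snd}) : Cost inp A (n + m) (components d) :=
  (h₁.union h₂).mono subset_rfl le_rfl (by rintro f (rfl | rfl) <;> simp)

theorem components_union_subset_mem {d e : θ → DualNumber ℝ} :
    (fun t => (d t).fst) ∈ A ∪ (components d ∪ components e) ∧
    (fun t => (d t).snd) ∈ A ∪ (components d ∪ components e) ∧
    (fun t => (e t).fst) ∈ A ∪ (components d ∪ components e) ∧
    (fun t => (e t).snd) ∈ A ∪ (components d ∪ components e) := by
  simp [components]

theorem Cost.dual_mul {d e : θ → DualNumber ℝ} (hd : Cost inp A n (components d))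
    (he : Cost inp A m (components e)) :
    Cost inp A (n + m + 4) (components fun t => d t * e t) := by
  obtain ⟨h1, h2, h3, h4⟩ := components_union_subset_mem (A := A) (d := d) (e := e)
  refine ((hd.union he).trans (Cost.components_intro (n := 1) (m := 3) ?_ ?_)).mono
    subset_rfl le_rfl Set.subset_union_right
  · exact ((Cost.of_mem h1).mul (Cost.of_mem h3)).mono subset_rfl le_rfl (by simp)
  · exact (((Cost.of_mem h1).mul (Cost.of_mem h4)).add
      ((Cost.of_mem h2).mul (Cost.of_mem h3))).mono subset_rfl le_rfl (by simp [mul_comm])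

theorem Cost.dual_add {d e : θ → DualNumber ℝ} (hd : Cost inp A n (components d))
    (he : Cost inp A m (components e)) :
    Cost inp A (n + m + 2) (components fun t => d t + e t) := by
  obtain ⟨h1, h2, h3, h4⟩ := components_union_subset_mem (A := A) (d := d) (e := e)
  refine ((hd.union he).trans (Cost.components_intro (n := 1) (m := 1) ?_ ?_)).mono
    subset_rfl le_rfl Set.subset_union_right
  · exact ((Cost.of_mem h1).add (Cost.of_mem h3)).mono subset_rfl le_rfl (by simp)
  · exact ((Cost.of_mem h2).add (Cost.of_mem h4)).mono subset_rfl le_rfl (by simp)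

theorem Cost.dual_sum (s : Finset κ) (F : κ → θ → DualNumber ℝ)
    (h : ∀ i ∈ s, components (F i) ⊆ A) :
    Cost inp A (2 * s.card + 2) (components fun t => ∑ i ∈ s, F i t) := by
  classical
  induction s using Finset.induction_on with
  | empty =>
    exact (Cost.components_intro
      ((Cost.const 0).mono subset_rfl le_rfl (by simp))
      ((Cost.const 0).mono subset_rfl le_rfl (by simp))).mono subset_rfl (by simp) subset_rfl
  | insert a s ha ih =>
    simp only [Finset.sum_insert ha, Finset.card_insert_of_notMem ha]
    exact ((Cost.of_subset (n := 0) (h a (by simp))).dual_add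
      (ih fun i hi => h i (by simp [hi]))).mono subset_rfl (by omega) subset_rfl

theorem Cost.dual_multiset_prod (s : Multiset κ) (F : κ → θ → DualNumber ℝ)
    (h : ∀ i ∈ s, components (F i) ⊆ A) :
    Cost inp A (4 * s.card + 2) (components fun t => (s.map fun i => F i t).prod) := by
  induction s using Multiset.induction_on with
  | empty =>
    exact (Cost.components_intro
      ((Cost.const 1).mono subset_rfl le_rfl (by simp))
      ((Cost.const 0).mono subset_rfl le_rfl (by simp))).mono subset_rfl (by simp) subset_rfl
  | cons a s ih =>
    simp only [Multiset.map_cons, Multiset.prod_cons, Multiset.card_cons]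
    exact ((Cost.of_subset (n := 0) (h a (by simp))).dual_mul
      (ih fun i hi => h i (by simp [hi]))).mono subset_rfl (by omega) subset_rfl

/-- A quantity of finite cost over the input cells is the output of a program. The two extra
instructions copy it into the last register. -/
theorem Cost.exists_program (h : Cost inp (Set.range fun i t => inp t i) n {f}) :
    ∃ prog : Program ι, prog.steps ≤ n + 2 ∧ ∀ t, prog.output (inp t) = f t := by
  obtain ⟨q, hq, hav⟩ := h [] <| by
    rintro _ ⟨i, rfl⟩
    exact ⟨.input i, fun _ _ => rfl⟩
  obtain ⟨o, ho⟩ := hav f rfl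
  obtain ⟨z, hz⟩ : Avail inp (q ++ [.const 0]) fun _ => (0 : ℝ) :=
    Avail.concat _ fun _ => by simp [Instr.value]
  refine ⟨q ++ [.const 0] ++ [.add o z], by simpa [Program.steps] using hq, fun t => ?_⟩
  have h₁ := ho [.const 0] t
  have h₂ := hz [] t
  simp only [List.nil_append, List.append_nil] at h₁ h₂
  rw [Program.output, Program.run_concat, Instr.value, h₁, h₂]
  simp

end Cost

/-! ### Summing out variables -/

section DependsOn

variable {V : Type*} {S : V → Type*} {R : Type*}

theorem dependsOn_finset_prod [CommMonoid R] {κ : Type*} {s : Finset κ}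
    {F : κ → (∀ v, S v) → R} {C : Finset V} (h : ∀ i ∈ s, DependsOn (F i) C) :
    DependsOn (fun x => ∏ i ∈ s, F i x) C :=
  fun _ _ hxy => Finset.prod_congr rfl fun i hi => h i hi hxy

end DependsOn

section SumOut

open Function

variable {V : Type*} [DecidableEq V] {S : V → Type*} [∀ v, Fintype (S v)]
  {R : Type*}

/-- The function obtained from `f` by summing over the values of the variables in `A`. It is
still defined on full configurations, but no longer depends on the coordinates in `A`. -/
def sumOut [AddCommMonoid R] (A : Finset V) (f : (∀ v, S v) → R) (x : ∀ v, S v) : R :=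
  ∑ a : Config S A, f (updateFinset x A a)

theorem sumOut_empty [AddCommMonoid R] (f : (∀ v, S v) → R) : sumOut ∅ f = f := by
  ext x; simp [sumOut]

theorem sumOut_union [AddCommMonoid R] {A B : Finset V} (h : Disjoint A B)
    (f : (∀ v, S v) → R) : sumOut (A ∪ B) f = sumOut A (sumOut B f) := by
  ext x
  simp only [sumOut]
  rw [← (Equiv.piFinsetUnion S h).sum_comp, Fintype.sum_prod_type]
  simp_rw [updateFinset_updateFinset h]

theorem sumOut_sdiff [AddCommMonoid R] {A B : Finset V} (h : B ⊆ A)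
    (f : (∀ v, S v) → R) : sumOut A f = sumOut (A \ B) (sumOut B f) := by
  rw [← sumOut_union Finset.sdiff_disjoint, Finset.sdiff_union_of_subset h]

theorem sumOut_mul_left [NonUnitalNonAssocSemiring R] {A : Finset V} {C : Set V}
    (h : ∀ v ∈ C, v ∉ A) {f g : (∀ v, S v) → R} (hf : DependsOn f C) :
    sumOut A (fun x => f x * g x) = fun x => f x * sumOut A g x := by
  ext x
  rw [sumOut, sumOut, Finset.mul_sum]
  refine Finset.sum_congr rfl fun a _ => ?_
  congr 1
  exact hf fun v hv => by simp [updateFinset, h v hv]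

theorem dependsOn_sumOut [AddCommMonoid R] {C : Finset V} (A : Finset V) {f : (∀ v, S v) → R}
    (hf : DependsOn f C) : DependsOn (sumOut A f) (C \ A : Finset V) := by
  intro x y hxy
  refine Finset.sum_congr rfl fun a _ => hf fun v hv => ?_
  by_cases hA : v ∈ A
  · simp [updateFinset, hA]
  · simpa [updateFinset, hA] using hxy v (by simpa [hA] using hv)

theorem sumOut_pos [∀ v, Nonempty (S v)] (A : Finset V) {f : (∀ v, S v) → ℝ}
    (hf : ∀ x, 0 < f x) (x : ∀ v, S v) : 0 < sumOut A f x :=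
  Finset.sum_pos (fun _ _ => hf _) Finset.univ_nonempty

/-- A product of local factors can be summed out factor by factor if every variable that is
summed out occurs in the scope of exactly one factor. -/
theorem sumOut_prod [CommSemiring R] (𝒩 : Finset (Finset V)) (F : Finset V → (∀ v, S v) → R)
    (hF : ∀ N ∈ 𝒩, DependsOn (F N) N) (A : Finset V) (hA : ∀ v ∈ A, ∃! N, N ∈ 𝒩 ∧ v ∈ N) :
    sumOut A (fun x => ∏ N ∈ 𝒩, F N x) = fun x => ∏ N ∈ 𝒩, sumOut (N ∩ A) (F N) x := by
  induction 𝒩 using Finset.induction_on generalizing A with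
  | empty =>
    obtain rfl : A = ∅ := Finset.eq_empty_of_forall_notMem fun v hv => by
      obtain ⟨N, hN, -⟩ := hA v hv; simp at hN
    simp [sumOut_empty]
  | insert N 𝒩 hN ih =>
    have hdisj : ∀ M ∈ 𝒩, Disjoint M (N ∩ A) := fun M hM => by
      refine Finset.disjoint_left.2 fun v hv hv' => ?_
      rw [Finset.mem_inter] at hv'
      have := (hA v hv'.2).unique ⟨Finset.mem_insert_self _ _, hv'.1⟩
        ⟨Finset.mem_insert_of_mem hM, hv⟩
      exact hN (this ▸ hM)
    have hrest := ih (fun M hM => hF M (Finset.mem_insert_of_mem hM)) (A \ N) fun v hv => by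
      rw [Finset.mem_sdiff] at hv
      obtain ⟨M, ⟨hM, hvM⟩, huniq⟩ := hA v hv.1
      refine ⟨M, ⟨(Finset.mem_insert.1 hM).resolve_left ?_, hvM⟩, fun M' hM' =>
        huniq M' ⟨Finset.mem_insert_of_mem hM'.1, hM'.2⟩⟩
      rintro rfl
      exact hv.2 hvM
    have hinter : ∀ M ∈ 𝒩, M ∩ (A \ N) = M ∩ A := fun M hM => by
      ext v
      have : v ∈ M → v ∉ N ∩ A := fun hv => Finset.disjoint_left.1 (hdisj M hM) hv
      simp only [Finset.mem_inter, Finset.mem_sdiff] at this ⊢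
      tauto
    have hprod : DependsOn (fun x => ∏ M ∈ 𝒩, F M x) ((N ∩ A : Finset V)ᶜ : Set V) :=
      fun x y hxy => Finset.prod_congr rfl fun M hM => hF M (Finset.mem_insert_of_mem hM)
        fun v hv => hxy v (Finset.disjoint_left.1 (hdisj M hM) hv)
    have hstep : sumOut (N ∩ A) (fun x => F N x * ∏ M ∈ 𝒩, F M x) =
        fun x => sumOut (N ∩ A) (F N) x * ∏ M ∈ 𝒩, F M x := by
      simp_rw [mul_comm _ (∏ M ∈ 𝒩, F M _)]
      exact sumOut_mul_left (fun _ hv => hv) hprod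
    simp only [Finset.prod_insert hN]
    rw [sumOut_sdiff (Finset.inter_subset_right : N ∩ A ⊆ A), hstep,
      sumOut_mul_left _ (dependsOn_sumOut _ (hF N (by simp))),
      Finset.sdiff_inter_self_right, hrest]
    · ext x
      exact congrArg _ (Finset.prod_congr rfl fun M hM =>
        congrArg (sumOut · (F M) x) (hinter M hM))
    · intro v
      simp only [Finset.coe_sdiff, Finset.coe_inter, Set.mem_sdiff, Set.mem_inter_iff,
        Finset.mem_coe, Finset.mem_sdiff, Finset.mem_inter]
      tauto

theorem sum_filter_eq_sumOut [Fintype V] [AddCommMonoid R] {p : (∀ v, S v) → Prop}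
    [DecidablePred p] (A : Finset V) (x : ∀ v, S v) (hp : ∀ y, p y ↔ ∀ v ∉ A, y v = x v)
    (f : (∀ v, S v) → R) : ∑ y with p y, f y = sumOut A f x := by
  symm
  refine Finset.sum_bij' (fun a _ => updateFinset x A a) (fun y _ => A.restrict y)
    ?_ ?_ ?_ ?_ ?_
  · intro a _
    simp only [Finset.mem_filter, Finset.mem_univ, true_and, hp]
    intro v hv
    simp [updateFinset, hv]
  · simp
  · intro a _
    exact restrict_updateFinset x a
  · intro y hy
    simp only [Finset.mem_filter, Finset.mem_univ, true_and, hp] at hy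
    ext v
    by_cases hv : v ∈ A <;> simp [updateFinset, hv, hy]
  · simp

end SumOut

/-! ### Simplicial vertices and maximal cliques of chordal graphs -/

section Chordal

variable {V : Type*} {G : SimpleGraph V}

theorem exists_isPath_isChordless {s t : V} (p₀ : G.Walk s t) :
    ∃ p : G.Walk s t, p.IsPath ∧ p.IsChordless ∧ p.support ⊆ p₀.support := by
  classical
  have hex : ∃ n, ∃ p : G.Walk s t, p.support ⊆ p₀.support ∧ p.length = n :=
    ⟨_, p₀, List.Subset.refl _, rfl⟩
  obtain ⟨p, hp, hlen⟩ := Nat.find_spec hex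
  have hmin : ∀ q : G.Walk s t, q.support ⊆ p₀.support → p.length ≤ q.length := fun q hq =>
    hlen ▸ Nat.find_min' hex ⟨q, hq, rfl⟩
  have hbyp : p.bypass.support ⊆ p₀.support :=
    List.Subset.trans p.support_bypass_subset_support hp
  refine ⟨p.bypass, p.bypass_isPath, ?_, hbyp⟩
  have hmin' : ∀ q : G.Walk s t, q.support ⊆ p₀.support → p.bypass.length ≤ q.length :=
    fun q hq => (p.length_bypass_le_length).trans (hmin q hq)
  generalize p.bypass = p at hbyp hmin'
  rw [SimpleGraph.Walk.isChordless_iff_forall_mem_edges]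
  intro a b ha hb hab
  rw [SimpleGraph.Walk.mem_support_iff_exists_getVert] at ha hb
  obtain ⟨i, rfl, hi⟩ := ha
  obtain ⟨j, rfl, hj⟩ := hb
  wlog hij : i ≤ j generalizing i j
  · rw [Sym2.eq_swap]
    exact this j hj i hi hab.symm (by omega)
  have hne : i ≠ j := by rintro rfl; exact hab.ne rfl
  by_cases hj' : j = i + 1
  · subst hj'
    exact p.mk_mem_edges_iff_exists.2 ⟨i, by omega, rfl⟩
  -- A chord joining positions `i` and `j > i + 1` would give a shortcut.
  · have := hmin' ((p.take i).append (.cons hab (p.drop j))) <| by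
      intro w hw
      rw [SimpleGraph.Walk.mem_support_append_iff, SimpleGraph.Walk.support_cons,
        List.mem_cons] at hw
      refine hbyp ?_
      rcases hw with hw | rfl | hw
      · exact (p.isSubwalk_take i).support_subset hw
      · exact p.getVert_mem_support i
      · exact (p.isSubwalk_drop j).support_subset hw
    rw [SimpleGraph.Walk.length_append, SimpleGraph.Walk.length_cons,
      SimpleGraph.Walk.drop_length] at this
    have := p.take_length i
    omega

/-- The vertex `v` is simplicial in the subgraph induced by `U`: its neighbours in `U` form a
clique. -/
def IsSimplicialIn (G : SimpleGraph V) (U : Finset V) (v : V) : Prop :=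
  ∀ a ∈ U, ∀ b ∈ U, G.Adj v a → G.Adj v b → a ≠ b → G.Adj a b

theorem exists_isSimplicialIn_of_forall {U : Finset V} (hU : U.Nonempty)
    (h : ∀ x ∈ U, ∀ y ∈ U, y ≠ x → ¬ G.Adj x y → ∃ v ∈ U, IsSimplicialIn G U v) :
    ∃ v ∈ U, IsSimplicialIn G U v := by
  by_cases hcl : ∀ x ∈ U, ∀ y ∈ U, y ≠ x → G.Adj x y
  · obtain ⟨v, hv⟩ := hU
    exact ⟨v, hv, fun a ha b hb _ _ hab => hcl a ha b hb hab.symm⟩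
  · push Not at hcl
    obtain ⟨x, hx, y, hy, hne, hadj⟩ := hcl
    exact h x hx y hy hne hadj

/-- Two neighbours of `x` that are joined by a walk whose inner vertices are neither `x` nor
adjacent to `x` are adjacent in a chordal graph. -/
theorem IsChordal.adj_of_walk (hG : IsChordal G) {x s t : V} (hs : G.Adj x s) (ht : G.Adj x t)
    (hst : s ≠ t) (p₀ : G.Walk s t)
    (hp₀ : ∀ w ∈ p₀.support, w = s ∨ w = t ∨ w ≠ x ∧ ¬ G.Adj x w) : G.Adj s t := by
  by_contra hadj
  obtain ⟨p, hpath, hcl, hsub⟩ := exists_isPath_isChordless p₀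
  have hxp : x ∉ p.support := fun hx => by
    rcases hp₀ x (hsub hx) with rfl | rfl | h
    exacts [hs.ne rfl, ht.ne rfl, h.1 rfl]
  have hlen : 2 ≤ p.length := by
    by_contra hlt
    have : p.length = 0 ∨ p.length = 1 := by omega
    rcases this with h | h
    · exact hst (SimpleGraph.Walk.eq_of_length_eq_zero h)
    · exact hadj (SimpleGraph.Walk.adj_of_length_eq_one h)
  have hcyc : (SimpleGraph.Walk.cons hs (p.concat ht.symm)).IsCycle := by
    rw [SimpleGraph.Walk.cons_isCycle_iff]
    refine ⟨hpath.concat hxp _, fun h => ?_⟩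
    rw [SimpleGraph.Walk.edges_concat, List.concat_eq_append, List.mem_append] at h
    rcases h with h | h
    · exact hxp (SimpleGraph.Walk.fst_mem_support_of_mem_edges _ h)
    · simp only [List.mem_singleton, Sym2.eq_iff] at h
      rcases h with ⟨h, -⟩ | ⟨-, h⟩
      exacts [ht.ne h, hst h]
  obtain ⟨a, ha, b, hb, hab, hnot⟩ := hG x _ hcyc (by simp; omega)
  simp only [SimpleGraph.Walk.support_cons, SimpleGraph.Walk.support_concat,
    SimpleGraph.Walk.edges_cons, SimpleGraph.Walk.edges_concat, List.concat_eq_append,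
    List.mem_cons, List.mem_append, List.not_mem_nil, or_false, not_or] at ha hb hnot
  have key : ∀ w ∈ p.support, G.Adj x w → w = s ∨ w = t := fun w hw hxw => by
    rcases hp₀ w (hsub hw) with h | h | h
    exacts [.inl h, .inr h, (h.2 hxw).elim]
  have ha' : a = x ∨ a ∈ p.support := by tauto
  have hb' : b = x ∨ b ∈ p.support := by tauto
  rcases ha' with rfl | ha' <;> rcases hb' with rfl | hb'
  · exact hab.ne rfl
  · rcases key b hb' hab with rfl | rfl
    exacts [hnot.1 rfl, hnot.2.2 Sym2.eq_swap]
  · rcases key a ha' hab.symm with rfl | rfl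
    exacts [hnot.1 Sym2.eq_swap, hnot.2.2 rfl]
  · exact hnot.2.1 (hcl.mem_edges ha' hb' hab)

/-- The inductive form of Dirac's theorem: a vertex `x` of an induced subgraph that has a
non-neighbour there also has a simplicial one. A component `B` of the non-neighbours of `x` has a
boundary `T` consisting of neighbours of `x`, and `T` is a clique; a simplicial vertex of
`B ∪ T` that lies in `B` is found by induction. -/
theorem IsChordal.exists_isSimplicialIn_not_adj (hG : IsChordal G) (U : Finset V) :
    ∀ x ∈ U, ∀ y ∈ U, y ≠ x → ¬ G.Adj x y →
      ∃ v ∈ U, v ≠ x ∧ ¬ G.Adj x v ∧ IsSimplicialIn G U v := by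
  classical
  induction U using Finset.strongInduction with
  | H U ih =>
  intro x hx y hy hyx hxy
  let D : Set V := {w | w ∈ U ∧ w ≠ x ∧ ¬ G.Adj x w}
  let B : Finset V := {b ∈ U | ∃ p : G.Walk y b, ∀ w ∈ p.support, w ∈ D}
  have hyB : y ∈ B := by
    refine Finset.mem_filter.2 ⟨hy, .nil, fun w hw => ?_⟩
    obtain rfl : w = y := by simpa using hw
    exact ⟨hy, hyx, hxy⟩
  have hBD : ∀ b ∈ B, b ∈ D := fun b hb => by
    obtain ⟨-, p, hp⟩ := Finset.mem_filter.1 hb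
    exact hp b p.end_mem_support
  have hclosed : ∀ b ∈ B, ∀ c ∈ D, G.Adj b c → c ∈ B := fun b hb c hc hbc => by
    obtain ⟨-, p, hp⟩ := Finset.mem_filter.1 hb
    refine Finset.mem_filter.2 ⟨hc.1, p.concat hbc, fun w hw => ?_⟩
    rw [SimpleGraph.Walk.support_concat, List.mem_append] at hw
    rcases hw with hw | hw
    · exact hp w hw
    · rw [List.mem_singleton] at hw
      exact hw ▸ hc
  let T : Finset V := {s ∈ U | s ∉ B ∧ ∃ b ∈ B, G.Adj b s}
  have hTadj : ∀ s ∈ T, G.Adj x s := fun s hs => by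
    obtain ⟨hsU, hsB, b, hb, hbs⟩ := Finset.mem_filter.1 hs
    by_contra hxs
    refine hsB (hclosed b hb s ⟨hsU, ?_, hxs⟩ hbs)
    rintro rfl
    exact (hBD b hb).2.2 hbs.symm
  have hTclique : ∀ s ∈ T, ∀ t ∈ T, s ≠ t → G.Adj s t := fun s hs t ht hst => by
    obtain ⟨-, -, b, hb, hbs⟩ := Finset.mem_filter.1 hs
    obtain ⟨-, -, c, hc, hct⟩ := Finset.mem_filter.1 ht
    obtain ⟨-, p, hp⟩ := Finset.mem_filter.1 hb
    obtain ⟨-, q, hq⟩ := Finset.mem_filter.1 hc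
    refine hG.adj_of_walk (hTadj s hs) (hTadj t ht) hst
      (.cons hbs.symm ((p.reverse.append q).concat hct)) fun w hw => ?_
    simp only [SimpleGraph.Walk.support_cons, SimpleGraph.Walk.support_concat,
      List.mem_cons, List.mem_append, List.not_mem_nil, or_false,
      SimpleGraph.Walk.mem_support_append_iff, SimpleGraph.Walk.support_reverse,
      List.mem_reverse] at hw
    rcases hw with rfl | (hw | hw) | rfl
    · exact .inl rfl
    · exact .inr (.inr (hp w hw).2)
    · exact .inr (.inr (hq w hw).2)
    · exact .inr (.inl rfl)
  have hxB : x ∉ B := fun h => (hBD x h).2.1 rfl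
  have hxT : x ∉ T := fun h => (hTadj x h).ne rfl
  have hBU : B ⊆ U := Finset.filter_subset _ _
  have hTU : T ⊆ U := Finset.filter_subset _ _
  -- A simplicial vertex of `B ∪ T` in `B` is simplicial in `U`: its neighbours are all there.
  suffices h : ∃ v ∈ B, IsSimplicialIn G (B ∪ T) v by
    obtain ⟨v, hv, hsimp⟩ := h
    have hnb : ∀ a ∈ U, G.Adj v a → a ∈ B ∪ T := fun a ha hva => by
      rw [Finset.mem_union]
      by_cases haB : a ∈ B
      · exact .inl haB
      · exact .inr (Finset.mem_filter.2 ⟨ha, haB, v, hv, hva⟩)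
    exact ⟨v, hBU hv, (hBD v hv).2.1, (hBD v hv).2.2, fun a ha b hb hva hvb =>
      hsimp a (hnb a ha hva) b (hnb b hb hvb) hva hvb⟩
  by_cases hdom : ∀ s ∈ T, ∀ w ∈ B ∪ T, w ≠ s → G.Adj s w
  · have hBss : B ⊂ U := (Finset.ssubset_iff_of_subset hBU).2 ⟨x, hx, hxB⟩
    obtain ⟨v, hv, hsimp⟩ := exists_isSimplicialIn_of_forall (G := G) ⟨y, hyB⟩
      fun a ha b hb hba hab => by
        obtain ⟨v, hv, -, -, h⟩ := ih B hBss a ha b hb hba hab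
        exact ⟨v, hv, h⟩
    refine ⟨v, hv, fun a ha b hb hva hvb hab => ?_⟩
    by_cases haT : a ∈ T
    · exact hdom a haT b hb hab.symm
    by_cases hbT : b ∈ T
    · exact (hdom b hbT a ha hab).symm
    · exact hsimp a ((Finset.mem_union.1 ha).resolve_right haT) b
        ((Finset.mem_union.1 hb).resolve_right hbT) hva hvb hab
  · push Not at hdom
    obtain ⟨s, hs, w, hw, hws, hsw⟩ := hdom
    have hss : B ∪ T ⊂ U := (Finset.ssubset_iff_of_subset (Finset.union_subset hBU hTU)).2
      ⟨x, hx, by simp [hxB, hxT]⟩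
    obtain ⟨v, hv, hvs, hsv, hsimp⟩ :=
      ih _ hss s (Finset.mem_union_right _ hs) w hw hws hsw
    refine ⟨v, (Finset.mem_union.1 hv).resolve_right fun hvT => ?_, hsimp⟩
    exact hsv (hTclique s hs v hvT hvs.symm)

/-- Dirac's theorem: every non-empty induced subgraph of a chordal graph has a simplicial
vertex. -/
theorem IsChordal.exists_isSimplicialIn (hG : IsChordal G) {U : Finset V} (hU : U.Nonempty) :
    ∃ v ∈ U, IsSimplicialIn G U v :=
  exists_isSimplicialIn_of_forall hU fun x hx y hy hyx hxy => by
    obtain ⟨v, hv, -, -, h⟩ := hG.exists_isSimplicialIn_not_adj U x hx y hy hyx hxy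
    exact ⟨v, hv, h⟩

theorem mem_maxCliquesIn {U C : Finset V} : C ∈ maxCliquesIn G U ↔
    C ⊆ U ∧ G.IsClique (C : Set V) ∧
      ∀ D ⊆ U, G.IsClique (D : Set V) → C ⊆ D → D = C := by
  simp only [maxCliquesIn, Finset.mem_filter, Finset.mem_powerset]
  constructor
  · rintro ⟨-, ⟨h1, h2⟩, h3⟩
    exact ⟨h1, h2, fun D hD hcl hCD => (h3 ⟨hD, hcl⟩ hCD).antisymm hCD⟩
  · rintro ⟨h1, h2, h3⟩
    exact ⟨h1, ⟨h1, h2⟩, fun D hD hCD => (h3 D hD.1 hD.2 hCD).le⟩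

theorem maxCliquesIn_nonempty (G : SimpleGraph V) (U : Finset V) :
    (maxCliquesIn G U).Nonempty := by
  classical
  obtain ⟨C, hC, hmax⟩ := Finset.exists_max_image
    (U.powerset.filter fun D : Finset V => G.IsClique (D : Set V)) Finset.card
    ⟨∅, by simp⟩
  rw [Finset.mem_filter, Finset.mem_powerset] at hC
  refine ⟨C, mem_maxCliquesIn.2 ⟨hC.1, hC.2, fun D hD hcl hCD => ?_⟩⟩
  exact (Finset.eq_of_subset_of_card_le hCD (hmax D (by simp [hD, hcl]))).symm

/-- The maximal cliques of a chordal graph are at most as many as its vertices, plus one for the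
empty graph: only one of them contains a given simplicial vertex. -/
theorem IsChordal.card_maxCliquesIn_le (hG : IsChordal G) (U : Finset V) :
    (maxCliquesIn G U).card ≤ U.card + 1 := by
  classical
  induction hn : U.card generalizing U with
  | zero =>
    rw [Finset.card_eq_zero] at hn
    subst hn
    refine Finset.card_le_one.2 fun C hC D hD => ?_
    rw [Finset.subset_empty.1 (mem_maxCliquesIn.1 hC).1,
      Finset.subset_empty.1 (mem_maxCliquesIn.1 hD).1]
  | succ n ih =>
    obtain ⟨v, hv, hsimp⟩ := hG.exists_isSimplicialIn (U := U)
      (Finset.card_pos.1 (by omega))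
    have hsub : maxCliquesIn G U ⊆
        insert (insert v {w ∈ U | G.Adj v w}) (maxCliquesIn G (U.erase v)) := by
      intro C hC
      obtain ⟨hCU, hcl, hmax⟩ := mem_maxCliquesIn.1 hC
      rw [Finset.mem_insert]
      by_cases hvC : v ∈ C
      · left
        refine (hmax _ ?_ ?_ ?_).symm
        · exact Finset.insert_subset hv (Finset.filter_subset _ _)
        · intro a ha b hb hab
          simp only [Finset.coe_insert, Finset.coe_filter, Set.mem_insert_iff,
            Set.mem_ofPred_eq] at ha hb
          rcases ha with rfl | ha <;> rcases hb with rfl | hb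
          · exact (hab rfl).elim
          · exact hb.2
          · exact ha.2.symm
          · exact hsimp a ha.1 b hb.1 ha.2 hb.2 hab
        · intro w hw
          rw [Finset.mem_insert, Finset.mem_filter]
          by_cases hwv : w = v
          · exact .inl hwv
          · exact .inr ⟨hCU hw, hcl hvC hw (Ne.symm hwv)⟩
      · right
        refine mem_maxCliquesIn.2 ⟨Finset.subset_erase.2 ⟨hCU, hvC⟩, hcl, fun D hD =>
          hmax D (hD.trans (Finset.erase_subset _ _))⟩
    have := ih (U.erase v) (by rw [Finset.card_erase_of_mem hv]; omega)
    have := Finset.card_le_card hsub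
    have := Finset.card_insert_le (insert v {w ∈ U | G.Adj v w}) (maxCliquesIn G (U.erase v))
    omega

end Chordal

/-! ### Variable elimination -/

section Entries

variable {V : Type*} {S : V → Type*} {θ : Type*}

/-- The real quantities that make up a table with values in the dual numbers. -/
def entries (T : θ → (∀ v, S v) → DualNumber ℝ) : Set (θ → ℝ) :=
  ⋃ x, components fun t => T t x

theorem components_subset_entries (T : θ → (∀ v, S v) → DualNumber ℝ) (x : ∀ v, S v) :
    components (fun t => T t x) ⊆ entries T :=
  Set.subset_iUnion (fun x => components fun t => T t x) x

theorem card_config_le [DecidableEq V] [∀ v, Fintype (S v)] {r : ℕ}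
    (hr : ∀ v, Fintype.card (S v) ≤ r) (C : Finset V) :
    Fintype.card (Config S C) ≤ r ^ C.card := by
  rw [Fintype.card_pi]
  have := Finset.prod_le_pow_card Finset.univ (fun v : C => Fintype.card (S v)) r fun v _ => hr v
  rwa [Finset.card_univ, Fintype.card_coe] at this

end Entries

section Elimination

open Function

variable {V : Type*} [DecidableEq V] {S : V → Type*} [∀ v, Fintype (S v)] [∀ v, Nonempty (S v)]
  {ι θ : Type*} {inp : θ → ι → ℝ} {A : Set (θ → ℝ)} {n r : ℕ}

/-- A table whose entry at `x` is only determined by the coordinates of `x` in `C` has at most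
`r ^ |C|` different entries. -/
theorem Cost.table (hr : ∀ v, Fintype.card (S v) ≤ r) (C : Finset V)
    (D : (∀ v, S v) → Set (θ → ℝ)) (hD : DependsOn D C) (h : ∀ x, Cost inp A n (D x)) :
    Cost inp A (r ^ C.card * n) (⋃ x, D x) := by
  let x₀ : ∀ v, S v := Classical.arbitrary _
  have := Cost.biUnion (inp := inp) (A := A) Finset.univ (fun _ => n)
    (fun a : Config S C => D (updateFinset x₀ C a)) fun a _ => h _
  refine this.mono subset_rfl ?_ ?_
  · simpa using Nat.mul_le_mul_right n (card_config_le hr C)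
  · refine Set.iUnion_subset fun x => ?_
    have hx : D x = D (updateFinset x₀ C (C.restrict x)) :=
      hD fun v hv => by simp [updateFinset, Finset.mem_coe.1 hv]
    rw [hx]
    exact Set.subset_biUnion_of_mem
      (u := fun a : Config S C => D (updateFinset x₀ C a)) (Finset.mem_univ _)

theorem Cost.dual_table (hr : ∀ v, Fintype.card (S v) ≤ r) {C : Finset V}
    {T : θ → (∀ v, S v) → DualNumber ℝ} (hT : ∀ t, DependsOn (T t) C)
    (h : ∀ x, Cost inp A n (components fun t => T t x)) :
    Cost inp A (r ^ C.card * n) (entries T) :=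
  .table hr C _ (fun x y hxy => by
    have : (fun t => T t x) = fun t => T t y := funext fun t => hT t hxy
    simp only [this]) h

/-- Variable elimination: in a chordal graph, the sum of a product of tables on cliques costs
`O((number of tables + number of variables) * r ^ k)` where `k` bounds the sizes of cliques.
Eliminating a simplicial variable `v` multiplies the tables whose scope contains `v` and sums
`v` out. All of this happens on the clique of `v` and its neighbours, so the scope of the
resulting table is again a clique. -/
theorem IsChordal.cost_sumOut_prod {H : SimpleGraph V} (hH : IsChordal H)
    (hr : ∀ v, Fintype.card (S v) ≤ r) (hr1 : 1 ≤ r) {k : ℕ}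
    (hk : ∀ C : Finset V, H.IsClique (C : Set V) → C.card ≤ k) (U : Finset V)
    (F : Multiset (Finset V × (θ → (∀ v, S v) → DualNumber ℝ)))
    (hF : ∀ p ∈ F, p.1 ⊆ U ∧ H.IsClique (p.1 : Set V) ∧ ∀ t, DependsOn (p.2 t) p.1)
    (hA : ∀ p ∈ F, entries p.2 ⊆ A) (x₀ : ∀ v, S v) :
    Cost inp A (6 * (F.card + 2 * U.card + 1) * r ^ k)
      (components fun t => sumOut U (fun x => (F.map fun p => p.2 t x).prod) x₀) := by
  induction hn : U.card generalizing U F A with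
  | zero =>
    rw [Finset.card_eq_zero] at hn
    subst hn
    simp only [sumOut_empty]
    refine (Cost.dual_multiset_prod F (fun p t => p.2 t x₀) fun p hp =>
      (components_subset_entries p.2 x₀).trans (hA p hp)).mono subset_rfl ?_ subset_rfl
    have : 1 ≤ r ^ k := Nat.one_le_pow _ _ hr1
    nlinarith [Nat.zero_le F.card]
  | succ n ih =>
    obtain ⟨v, hv, hsimp⟩ := hH.exists_isSimplicialIn (U := U) (Finset.card_pos.1 (by omega))
    set F₁ := F.filter fun p => v ∈ p.1 with hF₁
    set F₂ := F.filter fun p => ¬ v ∈ p.1 with hF₂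
    have hF₁₂ : F₁ + F₂ = F := Multiset.filter_add_not _ F
    have hcard : F₁.card + F₂.card = F.card := by rw [← Multiset.card_add, hF₁₂]
    have := Classical.decRel H.Adj
    let C : Finset V := {w ∈ U | H.Adj v w}
    have hvC : v ∉ C := by simp [C]
    have hCU : C ⊆ U.erase v := fun w hw =>
      Finset.mem_erase.2 ⟨fun h => hvC (h ▸ hw), (Finset.mem_filter.1 hw).1⟩
    have hCcl : H.IsClique (C : Set V) := by
      intro a ha b hb hab
      simp only [C, Finset.coe_filter, Set.mem_ofPred_eq] at ha hb
      exact hsimp a ha.1 b hb.1 ha.2 hb.2 hab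
    have hvCcl : H.IsClique (insert v C : Finset V) := by
      rw [Finset.coe_insert]
      exact hCcl.insert fun b hb _ => (Finset.mem_filter.1 hb).2
    let T : θ → (∀ v, S v) → DualNumber ℝ := fun t x => (F₁.map fun p => p.2 t x).prod
    have hT : ∀ t, DependsOn (T t) (insert v C : Finset V) := fun t x y hxy => by
      refine congrArg Multiset.prod (Multiset.map_congr rfl fun p hp => ?_)
      rw [hF₁, Multiset.mem_filter] at hp
      obtain ⟨hpU, hpcl, hdep⟩ := hF p hp.1
      refine hdep t fun w hw => hxy w ?_
      rw [Finset.mem_coe, Finset.mem_insert, Finset.mem_filter]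
      by_cases hwv : w = v
      · exact .inl hwv
      · exact .inr ⟨hpU hw, hpcl hp.2 hw (Ne.symm hwv)⟩
    let T' : θ → (∀ v, S v) → DualNumber ℝ := fun t => sumOut {v} (T t)
    have hT' : ∀ t, DependsOn (T' t) C := fun t => by
      have := dependsOn_sumOut {v} (hT t)
      rwa [Finset.sdiff_singleton_eq_erase, Finset.erase_insert hvC] at this
    have hvCk : C.card + 1 ≤ k := Finset.card_insert_of_notMem hvC ▸ hk _ hvCcl
    have hcost : Cost inp A (r ^ k * (4 * F₁.card + 2)) (entries T) :=
      (Cost.dual_table hr hT fun x => Cost.dual_multiset_prod F₁ (fun p t => p.2 t x) fun p hp =>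
        (components_subset_entries p.2 x).trans
          (hA p (Multiset.mem_of_mem_filter hp))).mono subset_rfl
        (Nat.mul_le_mul_right _ (Nat.pow_le_pow_right hr1 (hk _ hvCcl))) subset_rfl
    have hcost' : Cost inp (A ∪ entries T) (r ^ k * 4) (entries T') := by
      refine (Cost.dual_table hr hT' fun x => Cost.dual_sum Finset.univ
        (fun (a : Config S {v}) t => T t (updateFinset x {v} a)) fun a _ =>
          (components_subset_entries T _).trans Set.subset_union_right).mono subset_rfl ?_
          subset_rfl
      have h1 : Fintype.card (Config S {v}) ≤ r := by
        simpa using card_config_le hr {v}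
      calc r ^ C.card * (2 * (Finset.univ : Finset (Config S {v})).card + 2)
          ≤ r ^ C.card * (r * 4) := Nat.mul_le_mul_left _ (by rw [Finset.card_univ]; omega)
        _ = r ^ (C.card + 1) * 4 := by ring
        _ ≤ r ^ k * 4 := Nat.mul_le_mul_right _ (Nat.pow_le_pow_right hr1 hvCk)
    have hrec := ih (A := A ∪ (entries T ∪ entries T')) (U.erase v)
      ((C, T') ::ₘ F₂) (fun p hp => by
        rcases Multiset.mem_cons.1 hp with rfl | hp
        · exact ⟨hCU, hCcl, hT'⟩
        · rw [hF₂, Multiset.mem_filter] at hp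
          obtain ⟨hpU, hpcl, hdep⟩ := hF p hp.1
          exact ⟨Finset.subset_erase.2 ⟨hpU, hp.2⟩, hpcl, hdep⟩)
      (fun p hp => by
        rcases Multiset.mem_cons.1 hp with rfl | hp
        · exact Set.subset_union_right.trans Set.subset_union_right
        · exact (hA p (Multiset.mem_of_mem_filter hp)).trans Set.subset_union_left)
      (by rw [Finset.card_erase_of_mem hv]; omega)
    have hsum : ∀ t, sumOut U (fun x => (F.map fun p => p.2 t x).prod) x₀ =
        sumOut (U.erase v) (fun x => (((C, T') ::ₘ F₂).map fun p => p.2 t x).prod) x₀ := by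
      intro t
      rw [sumOut_sdiff (Finset.singleton_subset_iff.2 hv), Finset.sdiff_singleton_eq_erase]
      congr 1
      simp only [Multiset.map_cons, Multiset.prod_cons, ← hF₁₂, Multiset.map_add,
        Multiset.prod_add]
      simp_rw [mul_comm _ (Multiset.prod (Multiset.map _ F₂))]
      refine sumOut_mul_left (C := {v}ᶜ) (fun w hw => by simpa using hw) fun x y hxy => ?_
      refine congrArg Multiset.prod (Multiset.map_congr rfl fun p hp => ?_)
      rw [hF₂, Multiset.mem_filter] at hp
      exact (hF p hp.1).2.2 t fun w hw => hxy w fun h => hp.2 (h ▸ hw)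
    simp only [hsum]
    refine ((hcost.trans hcost').trans hrec).mono subset_rfl ?_ Set.subset_union_right
    rw [Multiset.card_cons, ← hcard]
    ring_nf
    nlinarith [Nat.zero_le (r ^ k * F₁.card)]

end Elimination

/-! ### Partitions of the maximal cliques and local marginals -/

section NPartition

theorem isClique_of_setsToCliques_le {V : Type*} {𝒩 : Finset (Finset V)}
    {H : SimpleGraph V}
    (h : setsToCliques 𝒩 ≤ H)
    {N : Finset V} (hN : N ∈ 𝒩) : H.IsClique (N : Set V) :=
  fun _ ha _ hb hab => h ⟨hab, N, hN, ha, hb⟩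

variable {V : Type*} [Fintype V] {G : SimpleGraph V} {Z : Finset V}
  {𝒩 : Finset (Finset V)}

theorem IsNPartition.biUnion_maxCliquesIn [DecidableEq V] (h : IsNPartition G Z 𝒩) :
    𝒩.biUnion (maxCliquesIn G) = maxCliques G := by
  ext C
  rw [Finset.mem_biUnion]
  constructor
  · rintro ⟨N, hN, hC⟩
    exact h.subset_cliques N hN hC
  · intro hC
    obtain ⟨N, hN, -⟩ := h.cliques_partition C hC
    exact ⟨N, hN⟩

theorem IsNPartition.pairwiseDisjoint (h : IsNPartition G Z 𝒩) :
    (𝒩 : Set (Finset V)).PairwiseDisjoint (maxCliquesIn G) := fun N hN M hM hNM => by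
  refine Finset.disjoint_left.2 fun C hC hC' => hNM ?_
  exact (h.cliques_partition C (h.subset_cliques N hN hC)).unique ⟨hN, hC⟩ ⟨hM, hC'⟩

theorem IsNPartition.sum_card_maxCliquesIn (h : IsNPartition G Z 𝒩) :
    ∑ N ∈ 𝒩, (maxCliquesIn G N).card = (maxCliques G).card := by
  classical
  rw [← h.biUnion_maxCliquesIn, Finset.card_biUnion h.pairwiseDisjoint]

theorem IsNPartition.card_le (h : IsNPartition G Z 𝒩) : 𝒩.card ≤ (maxCliques G).card := by
  rw [← h.sum_card_maxCliquesIn, Finset.card_eq_sum_ones]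
  exact Finset.sum_le_sum fun N _ => (maxCliquesIn_nonempty G N).card_pos

end NPartition

section Potential

variable {V : Type*} [Fintype V] [DecidableEq V] {S : V → Type*} [∀ v, Fintype (S v)]
  {G : SimpleGraph V} {Z : Finset V} {𝒩 : Finset (Finset V)}

/-- The table of the maximal clique `C`, as a function on full configurations; the constant `1`
if `C` is not a maximal clique. -/
noncomputable def DecomposableModel.table (M : DecomposableModel G S) (C : Finset V)
    (x : ∀ v, S v) : ℝ :=
  if h : C ∈ maxCliques G then M.cpt ⟨C, h⟩ (C.restrict x) else 1

/-- The product of the tables of those maximal cliques that lie in `N`. -/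
noncomputable def DecomposableModel.potential (M : DecomposableModel G S) (N : Finset V)
    (x : ∀ v, S v) : ℝ :=
  ∏ C ∈ maxCliquesIn G N, M.table C x

/-- The potential of `N`, with the variables outside `B` summed out. -/
noncomputable def DecomposableModel.localMarginal (M : DecomposableModel G S) (B N : Finset V)
    (x : ∀ v, S v) : ℝ :=
  sumOut (N \ B) (M.potential N) x

variable (M : DecomposableModel G S)

theorem DecomposableModel.dependsOn_table (C : Finset V) : DependsOn (M.table C) C := by
  intro x y hxy
  have : C.restrict x = C.restrict y := funext fun v => hxy v v.2
  simp only [table, this]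

theorem DecomposableModel.dependsOn_potential (N : Finset V) : DependsOn (M.potential N) N :=
  dependsOn_finset_prod fun C hC =>
    (M.dependsOn_table C).mono (Finset.coe_subset.2 (mem_maxCliquesIn.1 hC).1)

theorem DecomposableModel.dependsOn_localMarginal (B N : Finset V) :
    DependsOn (M.localMarginal B N) (N ∩ B : Finset V) := by
  have := dependsOn_sumOut (N \ B) (M.dependsOn_potential N)
  rwa [sdiff_sdiff_right_self] at this

theorem DecomposableModel.table_pos (C : Finset V) (x : ∀ v, S v) : 0 < M.table C x := by
  unfold table
  split_ifs with h
  exacts [M.cpt_pos _ _, one_pos]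

theorem DecomposableModel.joint_pos (x : ∀ v, S v) : 0 < M.joint x :=
  Finset.prod_pos fun _ _ => M.cpt_pos _ _

theorem DecomposableModel.localMarginal_pos [∀ v, Nonempty (S v)] (B N : Finset V)
    (x : ∀ v, S v) : 0 < M.localMarginal B N x :=
  sumOut_pos _ (fun _ => Finset.prod_pos fun C _ => M.table_pos C _) x

theorem DecomposableModel.joint_eq_prod_potential (h : IsNPartition G Z 𝒩) (x : ∀ v, S v) :
    M.joint x = ∏ N ∈ 𝒩, M.potential N x := by
  have : M.joint x = ∏ C : maxCliques G, M.table C.1 x :=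
    Finset.prod_congr rfl fun C _ => by rw [table, dif_pos C.2]
  rw [this, Finset.prod_coe_sort (maxCliques G) fun C => M.table C x, ← h.biUnion_maxCliquesIn,
    Finset.prod_biUnion h.pairwiseDisjoint]
  rfl

/-- A marginal that keeps the variables in `Z` is the product of the local marginals, because the
variables that are summed out are distributed over the members of the partition. -/
theorem DecomposableModel.sumOut_joint (h : IsNPartition G Z 𝒩) {B : Finset V} (hB : Z ⊆ B)
    (x : ∀ v, S v) : sumOut Bᶜ M.joint x = ∏ N ∈ 𝒩, M.localMarginal B N x := by
  have hj : M.joint = fun x => ∏ N ∈ 𝒩, M.potential N x :=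
    funext (M.joint_eq_prod_potential h)
  rw [hj, sumOut_prod 𝒩 M.potential (fun N _ => M.dependsOn_potential N) Bᶜ fun v hv =>
    h.compl_partition v fun hZ => Finset.mem_compl.1 hv (hB hZ)]
  simp only [localMarginal, Finset.sdiff_eq_inter_compl]

end Potential

/-! ### The divergence as a sum over configurations -/

section Divergence

open Function

variable {V : Type*} [Fintype V] [DecidableEq V] {S : V → Type*} [∀ v, Fintype (S v)]

theorem marginal_restrict (p : (∀ v, S v) → ℝ) (A : Finset V) (x : ∀ v, S v) :
    marginal p A (A.restrict x) = sumOut Aᶜ p x := by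
  classical
  refine sum_filter_eq_sumOut _ x (fun y => ?_) p
  simp [funext_iff]

theorem conditional_restrict (p : (∀ v, S v) → ℝ) (Y Z : Finset V) (x : ∀ v, S v) :
    conditional p Y Z (Z.restrict x) (Y.restrict x) =
      sumOut (Y ∪ Z)ᶜ p x / sumOut Zᶜ p x := by
  classical
  rw [conditional, marginal_restrict]
  congr 1
  refine sum_filter_eq_sumOut _ x (fun y => ?_) p
  simp only [funext_iff, Subtype.forall, Finset.restrict, Finset.mem_compl, not_not,
    Finset.mem_union, or_imp, forall_and]

theorem condABDiv_eq_sumOut (α β : ℝ) (p q : (∀ v, S v) → ℝ) {Y Z : Finset V}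
    (hYZ : Disjoint Y Z) (x₀ : ∀ v, S v) :
    condABDiv α β p q Y Z = sumOut (Y ∪ Z) (fun x => sumOut Zᶜ p x *
      abTerm α β (sumOut (Y ∪ Z)ᶜ p x / sumOut Zᶜ p x)
        (sumOut (Y ∪ Z)ᶜ q x / sumOut Zᶜ q x)) x₀ := by
  simp only [← conditional_restrict]
  simp only [← marginal_restrict]
  rw [Finset.union_comm, sumOut_union hYZ.symm]
  simp only [condABDiv, abDiv, sumOut, Finset.mul_sum]
  refine Finset.sum_congr rfl fun z _ => Finset.sum_congr rfl fun y _ => ?_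
  have hY : Y.restrict (updateFinset (updateFinset x₀ Z z) Y y) = y := restrict_updateFinset _ _
  have hZ : Z.restrict (updateFinset (updateFinset x₀ Z z) Y y) = z := by
    ext v
    simp [updateFinset, Finset.disjoint_right.1 hYZ v.2]
  rw [hY, hZ]

/-- One formula for the two cases of the divergence in which exactly one parameter vanishes:
`α + β` is the other one, and the quotients `α / (α + β)` and `β / (α + β)` are `0` and `1` in some
order. -/
theorem abTerm_eq {α β p q : ℝ} (h : α = 0 ∧ β ≠ 0 ∨ α ≠ 0 ∧ β = 0) (hp : 0 < p) (hq : 0 < q) :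
    abTerm α β p q =
      α / (α + β) * ((p ^ (α + β) * (Real.log (p ^ (α + β)) - Real.log (q ^ (α + β))) -
        p ^ (α + β) + q ^ (α + β)) / ((α + β) * (α + β))) +
      β / (α + β) * ((0 - q ^ (α + β) * (Real.log (p ^ (α + β)) - Real.log (q ^ (α + β))) -
        q ^ (α + β) + p ^ (α + β)) / ((α + β) * (α + β))) := by
  rcases h with ⟨rfl, hβ⟩ | ⟨hα, rfl⟩
  · have hp' := (Real.rpow_pos_of_pos hp β).ne'
    have hq' := (Real.rpow_pos_of_pos hq β).ne'
    simp only [abTerm, ne_eq, not_true_eq_false, false_and, if_false, hβ, not_false_eq_true,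
      and_self, if_true, zero_add, zero_div, zero_mul, div_self hβ, one_mul,
      Real.log_div hq' hp']
    ring
  · have hp' := (Real.rpow_pos_of_pos hp α).ne'
    have hq' := (Real.rpow_pos_of_pos hq α).ne'
    simp only [abTerm, ne_eq, not_true_eq_false, false_and, and_false, if_false, hα,
      not_false_eq_true, and_self, if_true, add_zero, zero_div, zero_mul, div_self hα, one_mul,
      Real.log_div hp' hq']
    ring

end Divergence

/-! ### Sums of a product times a sum, by dual numbers -/

section Weighted

/-- The dual number `a * (1 + l * ε)`. A product of such numbers carries the product of the `a`
in its first component, and in the second one this product times the sum of the `l`. -/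
noncomputable def weighted (a l : ℝ) : DualNumber ℝ :=
  TrivSqZeroExt.inl a + TrivSqZeroExt.inr (a * l)

@[simp] theorem fst_weighted (a l : ℝ) : (weighted a l).fst = a := by simp [weighted]

@[simp] theorem snd_weighted (a l : ℝ) : (weighted a l).snd = a * l := by simp [weighted]

theorem weighted_mul_weighted (a b l m : ℝ) :
    weighted a l * weighted b m = weighted (a * b) (l + m) := by
  ext
  · simp
  · simp
    ring

theorem prod_weighted {κ : Type*} (s : Finset κ) (a l : κ → ℝ) :
    ∏ i ∈ s, weighted (a i) (l i) = weighted (∏ i ∈ s, a i) (∑ i ∈ s, l i) := by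
  classical
  induction s using Finset.induction_on with
  | empty => ext <;> simp
  | insert i s hi ih =>
    rw [Finset.prod_insert hi, Finset.prod_insert hi, Finset.sum_insert hi, ih,
      weighted_mul_weighted]

variable {V : Type*} [DecidableEq V] {S : V → Type*} [∀ v, Fintype (S v)]

theorem fst_sumOut (A : Finset V) (f : (∀ v, S v) → DualNumber ℝ) (x : ∀ v, S v) :
    (sumOut A f x).fst = sumOut A (fun x => (f x).fst) x :=
  TrivSqZeroExt.fst_sum _ _

theorem snd_sumOut (A : Finset V) (f : (∀ v, S v) → DualNumber ℝ) (x : ∀ v, S v) :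
    (sumOut A f x).snd = sumOut A (fun x => (f x).snd) x :=
  TrivSqZeroExt.snd_sum _ _

end Weighted

/-! ### Cost of the local factors and of their sums -/

section Factors

open Function

variable {V : Type*} [Fintype V] [DecidableEq V] {S : V → Type*} [∀ v, Fintype (S v)]
  [∀ v, Nonempty (S v)] {G GP GQ : SimpleGraph V} {ι θ : Type*} {inp : θ → ι → ℝ}
  {A : Set (θ → ℝ)} {r : ℕ}

theorem Cost.potential (hr : ∀ v, Fintype.card (S v) ≤ r) {M : θ → DecomposableModel G S}
    (hM : ∀ C x, (fun t => (M t).cpt C x) ∈ A) {N : Finset V}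
    (hN : maxCliquesIn G N ⊆ maxCliques G) :
    Cost inp A (r ^ N.card * ((maxCliquesIn G N).card + 1))
      (⋃ x, {fun t => (M t).potential N x}) := by
  refine .table hr N _ (fun x y hxy => ?_) fun x => ?_
  · have : (fun t => (M t).potential N x) = fun t => (M t).potential N y :=
      funext fun t => (M t).dependsOn_potential N hxy
    simp only [this]
  · refine (Cost.prod (n := 0) (maxCliquesIn G N) (fun C t => (M t).table C x)
      fun C hC => ?_).mono subset_rfl (by simp) subset_rfl
    simp only [DecomposableModel.table, dif_pos (hN hC)]
    exact .of_mem (hM _ _)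

theorem Cost.localMarginal (hr : ∀ v, Fintype.card (S v) ≤ r) (hr1 : 1 ≤ r)
    {M : θ → DecomposableModel G S} (hM : ∀ C x, (fun t => (M t).cpt C x) ∈ A) {N : Finset V}
    (hN : maxCliquesIn G N ⊆ maxCliques G) (B : Finset V) :
    Cost inp A (r ^ N.card * ((maxCliquesIn G N).card + 3))
      (⋃ x, {fun t => (M t).localMarginal B N x}) := by
  have hsum : Cost inp (A ∪ ⋃ x, {fun t => (M t).potential N x})
      (r ^ (N ∩ B).card * (2 * r ^ (N \ B).card))
      (⋃ x, {fun t => (M t).localMarginal B N x}) := by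
    refine .table hr (N ∩ B) _ (fun x y hxy => ?_) fun x => ?_
    · have : (fun t => (M t).localMarginal B N x) = fun t => (M t).localMarginal B N y :=
        funext fun t => (M t).dependsOn_localMarginal B N hxy
      simp only [this]
    · refine (Cost.sum (n := 0) (Finset.univ : Finset (Config S (N \ B)))
        (fun a t => (M t).potential N (updateFinset x (N \ B) a)) fun a _ =>
        .of_mem (.inr (Set.mem_iUnion.2 ⟨_, rfl⟩))).mono subset_rfl ?_ subset_rfl
      have h1 := card_config_le hr (N \ B)
      have h2 : 1 ≤ r ^ (N \ B).card := Nat.one_le_pow _ _ hr1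
      rw [Finset.card_univ]
      omega
  refine ((Cost.potential hr hM hN).trans hsum).mono subset_rfl (le_of_eq ?_)
    Set.subset_union_right
  rw [← Finset.card_inter_add_card_sdiff N B, pow_add]
  ring

/-- The table of a factor that is computed pointwise, in few steps, from the local marginals of
`N` over `Z` and over `Y ∪ Z`. -/
theorem Cost.factor (hr : ∀ v, Fintype.card (S v) ≤ r) (hr1 : 1 ≤ r)
    {M : θ → DecomposableModel G S} (hM : ∀ C x, (fun t => (M t).cpt C x) ∈ A) {N : Finset V}
    (hN : maxCliquesIn G N ⊆ maxCliques G) (Y Z : Finset V) {c : ℕ}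
    {h : θ → ℝ → ℝ → DualNumber ℝ}
    (hh : ∀ (A' : Set (θ → ℝ)) (f g : θ → ℝ), A ⊆ A' → f ∈ A' → g ∈ A' →
      Cost inp A' c (components fun t => h t (f t) (g t))) :
    Cost inp A (r ^ N.card * (2 * (maxCliquesIn G N).card + 6 + c))
      (entries fun t x => h t ((M t).localMarginal Z N x) ((M t).localMarginal (Y ∪ Z) N x)) := by
  refine (((Cost.localMarginal hr hr1 hM hN Z).union
    (Cost.localMarginal hr hr1 hM hN (Y ∪ Z))).trans (Cost.dual_table hr (C := N) (n := c)
      (fun t x y hxy => ?_) fun x => hh _ _ _ Set.subset_union_left ?_ ?_)).mono subset_rfl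
      (le_of_eq (by ring)) Set.subset_union_right
  · have h1 : ∀ B, (M t).localMarginal B N x = (M t).localMarginal B N y := fun B =>
      (M t).dependsOn_localMarginal B N fun v hv => hxy v (Finset.inter_subset_left hv)
    simp only [h1]
  · exact .inr (.inl (Set.mem_iUnion.2 ⟨x, rfl⟩))
  · exact .inr (.inr (Set.mem_iUnion.2 ⟨x, rfl⟩))

/-- The sum, over the configurations of `Y ∪ Z`, of a product of factors that belong to the
members of the two partitions, by variable elimination in the computation graph. Every member of
a partition contains a maximal clique of its own, so there are at most `2 * |V|` factors for each
model. -/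
theorem Cost.sumOut_factors [Nonempty V] (hr : ∀ v, Fintype.card (S v) ≤ r) (hr1 : 1 ≤ r)
    (hGP : IsChordal GP) (hGQ : IsChordal GQ) {Y Z : Finset V} {NP NQ : Finset (Finset V)}
    (hNP : IsNPartition GP Z NP) (hNQ : IsNPartition GQ Z NQ) {H : SimpleGraph V}
    (hH : IsComputationGraph H (setsToCliques NP) (setsToCliques NQ))
    {P : θ → DecomposableModel GP S} {Q : θ → DecomposableModel GQ S}
    (hP : ∀ C x, (fun t => (P t).cpt C x) ∈ A) (hQ : ∀ C x, (fun t => (Q t).cpt C x) ∈ A)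
    {c : ℕ} {h h' : θ → ℝ → ℝ → DualNumber ℝ}
    (hh : ∀ (A' : Set (θ → ℝ)) (f g : θ → ℝ), A ⊆ A' → f ∈ A' → g ∈ A' →
      Cost inp A' c (components fun t => h t (f t) (g t)))
    (hh' : ∀ (A' : Set (θ → ℝ)) (f g : θ → ℝ), A ⊆ A' → f ∈ A' → g ∈ A' →
      Cost inp A' c (components fun t => h' t (f t) (g t))) (x₀ : ∀ v, S v) :
    Cost inp A ((4 * c + 74) * (Fintype.card V * r ^ (chordalTreewidth H + 1)))
      (components fun t => sumOut (Y ∪ Z) (fun x =>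
        (∏ N ∈ NP, h t ((P t).localMarginal Z N x) ((P t).localMarginal (Y ∪ Z) N x)) *
        ∏ N ∈ NQ, h' t ((Q t).localMarginal Z N x) ((Q t).localMarginal (Y ∪ Z) N x)) x₀) := by
  have hV : 1 ≤ Fintype.card V := Fintype.card_pos
  have hk : ∀ C : Finset V, H.IsClique (C : Set V) → C.card ≤ chordalTreewidth H + 1 := by
    intro C hC
    have := hC.card_le_cliqueNum
    rw [chordalTreewidth]
    omega
  set k := chordalTreewidth H + 1
  have hclP : ∀ N ∈ NP, H.IsClique (N : Set V) := fun N =>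
    isClique_of_setsToCliques_le hH.left_le
  have hclQ : ∀ N ∈ NQ, H.IsClique (N : Set V) := fun N =>
    isClique_of_setsToCliques_le hH.right_le
  let TP : Finset V → θ → (∀ v, S v) → DualNumber ℝ := fun N t x =>
    h t ((P t).localMarginal Z N x) ((P t).localMarginal (Y ∪ Z) N x)
  let TQ : Finset V → θ → (∀ v, S v) → DualNumber ℝ := fun N t x =>
    h' t ((Q t).localMarginal Z N x) ((Q t).localMarginal (Y ∪ Z) N x)
  have hcP : Cost inp A (∑ N ∈ NP, r ^ k * (2 * (maxCliquesIn GP N).card + 6 + c))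
      (⋃ N ∈ NP, entries (TP N)) := .biUnion _ _ _ fun N hN =>
    (Cost.factor hr hr1 hP (hNP.subset_cliques N hN) Y Z hh).mono subset_rfl
      (Nat.mul_le_mul_right _ (Nat.pow_le_pow_right hr1 (hk N (hclP N hN)))) subset_rfl
  have hcQ : Cost inp A (∑ N ∈ NQ, r ^ k * (2 * (maxCliquesIn GQ N).card + 6 + c))
      (⋃ N ∈ NQ, entries (TQ N)) := .biUnion _ _ _ fun N hN =>
    (Cost.factor hr hr1 hQ (hNQ.subset_cliques N hN) Y Z hh').mono subset_rfl
      (Nat.mul_le_mul_right _ (Nat.pow_le_pow_right hr1 (hk N (hclQ N hN)))) subset_rfl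
  have hdep : ∀ (N : Finset V), N ∩ Z ⊆ N ∩ (Y ∪ Z) := fun N =>
    Finset.inter_subset_inter_left Finset.subset_union_right
  have hdepP : ∀ N t, DependsOn (TP N t) (N ∩ (Y ∪ Z) : Finset V) := fun N t x y hxy => by
    simp only [TP]
    rw [(P t).dependsOn_localMarginal Z N fun v hv => hxy v (hdep N hv),
      (P t).dependsOn_localMarginal (Y ∪ Z) N hxy]
  have hdepQ : ∀ N t, DependsOn (TQ N t) (N ∩ (Y ∪ Z) : Finset V) := fun N t x y hxy => by
    simp only [TQ]
    rw [(Q t).dependsOn_localMarginal Z N fun v hv => hxy v (hdep N hv),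
      (Q t).dependsOn_localMarginal (Y ∪ Z) N hxy]
  -- Both the local marginals are tables on the clique `N ∩ (Y ∪ Z)` of `H`. A multiset is used
  -- because a factor may occur several times.
  let F : Multiset (Finset V × (θ → (∀ v, S v) → DualNumber ℝ)) :=
    NP.val.map (fun N => (N ∩ (Y ∪ Z), TP N)) + NQ.val.map (fun N => (N ∩ (Y ∪ Z), TQ N))
  have hF : ∀ p ∈ F, (∃ N ∈ NP, p = (N ∩ (Y ∪ Z), TP N)) ∨
      ∃ N ∈ NQ, p = (N ∩ (Y ∪ Z), TQ N) := by
    intro p hp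
    simp only [F, Multiset.mem_add, Multiset.mem_map, Finset.mem_val] at hp
    rcases hp with ⟨N, hN, rfl⟩ | ⟨N, hN, rfl⟩
    exacts [.inl ⟨N, hN, rfl⟩, .inr ⟨N, hN, rfl⟩]
  have helim := hH.chordal.cost_sumOut_prod (inp := inp)
    (A := A ∪ ((⋃ N ∈ NP, entries (TP N)) ∪ ⋃ N ∈ NQ, entries (TQ N))) hr hr1 hk (Y ∪ Z) F
    (fun p hp => by
      rcases hF p hp with ⟨N, hN, rfl⟩ | ⟨N, hN, rfl⟩
      · exact ⟨Finset.inter_subset_right,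
          (hclP N hN).subset (Finset.coe_subset.2 Finset.inter_subset_left), hdepP N⟩
      · exact ⟨Finset.inter_subset_right,
          (hclQ N hN).subset (Finset.coe_subset.2 Finset.inter_subset_left), hdepQ N⟩)
    (fun p hp => by
      rcases hF p hp with ⟨N, hN, rfl⟩ | ⟨N, hN, rfl⟩
      · exact fun f hf => .inr (.inl (Set.mem_biUnion hN hf))
      · exact fun f hf => .inr (.inr (Set.mem_biUnion hN hf))) x₀
  have hFprod : ∀ t x, (F.map fun p => p.2 t x).prod =
      (∏ N ∈ NP, TP N t x) * ∏ N ∈ NQ, TQ N t x := fun t x => by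
    simp only [F, Multiset.map_add, Multiset.prod_add, Multiset.map_map]
    rfl
  simp only [hFprod] at helim
  refine ((hcP.union hcQ).trans helim).mono subset_rfl ?_ Set.subset_union_right
  have hFcard : F.card = NP.card + NQ.card := by simp [F]
  have hmP := hGP.card_maxCliquesIn_le Finset.univ
  have hmQ := hGQ.card_maxCliquesIn_le Finset.univ
  have hsP := hNP.sum_card_maxCliquesIn
  have hsQ := hNQ.sum_card_maxCliquesIn
  have hlP := hNP.card_le
  have hlQ := hNQ.card_le
  have hU : (Y ∪ Z).card ≤ Fintype.card V := Finset.card_le_univ _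
  rw [Finset.card_univ] at hmP hmQ
  simp only [maxCliques] at hsP hsQ hlP hlQ
  rw [← Finset.mul_sum, ← Finset.mul_sum, Finset.sum_add_distrib, Finset.sum_add_distrib,
    Finset.sum_add_distrib, Finset.sum_add_distrib, ← Finset.mul_sum, ← Finset.mul_sum, hsP, hsQ,
    hFcard]
  simp only [Finset.sum_const, smul_eq_mul]
  generalize r ^ k = R at *
  generalize Fintype.card V = n at *
  generalize (maxCliquesIn GP Finset.univ).card = mP at *
  generalize (maxCliquesIn GQ Finset.univ).card = mQ at *
  generalize (Y ∪ Z).card = u at *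
  generalize NP.card = p at *
  generalize NQ.card = q at *
  have h1 : p * c ≤ 2 * n * c := Nat.mul_le_mul_right c (by omega)
  have h2 : q * c ≤ 2 * n * c := Nat.mul_le_mul_right c (by omega)
  calc _ = (2 * mP + p * 6 + p * c + (2 * mQ + q * 6 + q * c) + 6 * (p + q + 2 * u + 1)) * R := by
        ring
    _ ≤ (4 * (n * c) + 74 * n) * R := Nat.mul_le_mul_right R (by
        have : 2 * n * c = 2 * (n * c) := by ring
        omega)
    _ = _ := by ring

end Factors

/-! ### The divergence in terms of local factors -/

section Sums

variable {V : Type*} [Fintype V] [DecidableEq V] {S : V → Type*} [∀ v, Fintype (S v)]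
  [∀ v, Nonempty (S v)] {GP GQ : SimpleGraph V}

/-- The local conditional probability `j / m` to the power `γ`, where `m` and `j` stand for the
local marginals of a member of a partition over `Z` and over `Y ∪ Z`. -/
noncomputable def localPower (γ m j : ℝ) : ℝ := (j / m) ^ γ

theorem prod_localPower {G : SimpleGraph V} (M : DecomposableModel G S) {Y Z : Finset V}
    {𝒩 : Finset (Finset V)} (h : IsNPartition G Z 𝒩) (γ : ℝ) (x : ∀ v, S v) :
    ∏ N ∈ 𝒩, localPower γ (M.localMarginal Z N x) (M.localMarginal (Y ∪ Z) N x) =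
      (sumOut (Y ∪ Z)ᶜ M.joint x / sumOut Zᶜ M.joint x) ^ γ := by
  simp only [localPower]
  rw [M.sumOut_joint h Finset.subset_union_right, M.sumOut_joint h (Finset.Subset.refl Z),
    ← Finset.prod_div_distrib, Real.finsetProd_rpow]
  exact fun N _ => (div_pos (M.localMarginal_pos _ _ _) (M.localMarginal_pos _ _ _)).le

theorem sum_log_localPower {G : SimpleGraph V} (M : DecomposableModel G S) {Y Z : Finset V}
    {𝒩 : Finset (Finset V)} (h : IsNPartition G Z 𝒩) (γ : ℝ) (x : ∀ v, S v) :
    ∑ N ∈ 𝒩, Real.log (localPower γ (M.localMarginal Z N x) (M.localMarginal (Y ∪ Z) N x)) =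
      Real.log ((sumOut (Y ∪ Z)ᶜ M.joint x / sumOut Zᶜ M.joint x) ^ γ) := by
  rw [← prod_localPower M h, Real.log_prod]
  exact fun N _ => (Real.rpow_pos_of_pos
    (div_pos (M.localMarginal_pos _ _ _) (M.localMarginal_pos _ _ _)) _).ne'

/-- The sum `∑ P_Z (1 + ε L) p ^ γ` over the configurations of `Y ∪ Z`, where `p` and `q` are the
conditional probabilities and `L = log (p ^ γ) - log (q ^ γ)`, in factorized form. -/
noncomputable def dualSumP (Y Z : Finset V) (NP NQ : Finset (Finset V)) (γ : ℝ)
    (P : DecomposableModel GP S) (Q : DecomposableModel GQ S) : (∀ v, S v) → DualNumber ℝ :=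
  sumOut (Y ∪ Z) fun x =>
    (∏ N ∈ NP, (fun m j => weighted (m * localPower γ m j) (Real.log (localPower γ m j)))
      (P.localMarginal Z N x) (P.localMarginal (Y ∪ Z) N x)) *
    ∏ N ∈ NQ, (fun m j => weighted 1 (-Real.log (localPower γ m j)))
      (Q.localMarginal Z N x) (Q.localMarginal (Y ∪ Z) N x)

/-- The sum `∑ P_Z (1 + ε L) q ^ γ` over the configurations of `Y ∪ Z`, where `p` and `q` are the
conditional probabilities and `L = log (p ^ γ) - log (q ^ γ)`, in factorized form. -/
noncomputable def dualSumQ (Y Z : Finset V) (NP NQ : Finset (Finset V)) (γ : ℝ)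
    (P : DecomposableModel GP S) (Q : DecomposableModel GQ S) : (∀ v, S v) → DualNumber ℝ :=
  sumOut (Y ∪ Z) fun x =>
    (∏ N ∈ NP, (fun m j => weighted m (Real.log (localPower γ m j)))
      (P.localMarginal Z N x) (P.localMarginal (Y ∪ Z) N x)) *
    ∏ N ∈ NQ, (fun m j => weighted (localPower γ m j) (-Real.log (localPower γ m j)))
      (Q.localMarginal Z N x) (Q.localMarginal (Y ∪ Z) N x)

variable {Y Z : Finset V} {NP NQ : Finset (Finset V)}

theorem dualSumP_eq (hNP : IsNPartition GP Z NP) (hNQ : IsNPartition GQ Z NQ) (γ : ℝ)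
    (P : DecomposableModel GP S) (Q : DecomposableModel GQ S) :
    dualSumP Y Z NP NQ γ P Q = sumOut (Y ∪ Z) fun x =>
      weighted (sumOut Zᶜ P.joint x * (sumOut (Y ∪ Z)ᶜ P.joint x / sumOut Zᶜ P.joint x) ^ γ)
        (Real.log ((sumOut (Y ∪ Z)ᶜ P.joint x / sumOut Zᶜ P.joint x) ^ γ) -
          Real.log ((sumOut (Y ∪ Z)ᶜ Q.joint x / sumOut Zᶜ Q.joint x) ^ γ)) := by
  simp only [dualSumP, prod_weighted, weighted_mul_weighted, Finset.prod_mul_distrib,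
    prod_localPower P hNP, sum_log_localPower P hNP, Finset.sum_neg_distrib,
    sum_log_localPower Q hNQ, Finset.prod_const_one, mul_one, ← sub_eq_add_neg,
    ← P.sumOut_joint hNP (Finset.Subset.refl Z)]

theorem dualSumQ_eq (hNP : IsNPartition GP Z NP) (hNQ : IsNPartition GQ Z NQ) (γ : ℝ)
    (P : DecomposableModel GP S) (Q : DecomposableModel GQ S) :
    dualSumQ Y Z NP NQ γ P Q = sumOut (Y ∪ Z) fun x =>
      weighted (sumOut Zᶜ P.joint x * (sumOut (Y ∪ Z)ᶜ Q.joint x / sumOut Zᶜ Q.joint x) ^ γ)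
        (Real.log ((sumOut (Y ∪ Z)ᶜ P.joint x / sumOut Zᶜ P.joint x) ^ γ) -
          Real.log ((sumOut (Y ∪ Z)ᶜ Q.joint x / sumOut Zᶜ Q.joint x) ^ γ)) := by
  simp only [dualSumQ, prod_weighted, weighted_mul_weighted,
    prod_localPower Q hNQ, sum_log_localPower P hNP, Finset.sum_neg_distrib,
    sum_log_localPower Q hNQ, ← sub_eq_add_neg,
    ← P.sumOut_joint hNP (Finset.Subset.refl Z)]

theorem condABDiv_eq_dualSum (hYZ : Disjoint Y Z) (hNP : IsNPartition GP Z NP)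
    (hNQ : IsNPartition GQ Z NQ) {α β : ℝ} (h : α = 0 ∧ β ≠ 0 ∨ α ≠ 0 ∧ β = 0)
    (P : DecomposableModel GP S) (Q : DecomposableModel GQ S) (x₀ : ∀ v, S v) :
    condABDiv α β P.joint Q.joint Y Z =
      α / (α + β) * (((dualSumP Y Z NP NQ (α + β) P Q x₀).snd -
        (dualSumP Y Z NP NQ (α + β) P Q x₀).fst +
        (dualSumQ Y Z NP NQ (α + β) P Q x₀).fst) / ((α + β) * (α + β))) +
      β / (α + β) * ((0 - (dualSumQ Y Z NP NQ (α + β) P Q x₀).snd -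
        (dualSumQ Y Z NP NQ (α + β) P Q x₀).fst +
        (dualSumP Y Z NP NQ (α + β) P Q x₀).fst) / ((α + β) * (α + β))) := by
  rw [condABDiv_eq_sumOut α β _ _ hYZ x₀, dualSumP_eq hNP hNQ, dualSumQ_eq hNP hNQ]
  have hpos : ∀ (A : Finset V) x, 0 < sumOut A P.joint x := fun A => sumOut_pos A P.joint_pos
  have hpos' : ∀ (A : Finset V) x, 0 < sumOut A Q.joint x := fun A => sumOut_pos A Q.joint_pos
  simp only [abTerm_eq h (div_pos (hpos _ _) (hpos _ _)) (div_pos (hpos' _ _) (hpos' _ _)),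
    fst_sumOut, snd_sumOut, fst_weighted, snd_weighted]
  generalize sumOut Zᶜ P.joint = pZ, sumOut Zᶜ Q.joint = qZ,
    sumOut (Y ∪ Z)ᶜ P.joint = pYZ, sumOut (Y ∪ Z)ᶜ Q.joint = qYZ
  simp only [sumOut]
  rw [zero_sub, ← Finset.sum_neg_distrib, ← Finset.sum_sub_distrib, ← Finset.sum_sub_distrib,
    ← Finset.sum_add_distrib, ← Finset.sum_add_distrib, Finset.sum_div, Finset.sum_div,
    Finset.mul_sum, Finset.mul_sum, ← Finset.sum_add_distrib]
  refine Finset.sum_congr rfl fun a _ => ?_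
  ring

theorem Cost.localPower {ι θ : Type*} {inp : θ → ι → ℝ} {A : Set (θ → ℝ)} {γ f g : θ → ℝ}
    (hγ : γ ∈ A) (hf : f ∈ A) (hg : g ∈ A) :
    Cost inp A 2 {fun t => DMDiv.localPower (γ t) (f t) (g t)} :=
  ((Cost.of_mem hg).div (Cost.of_mem hf)).pow (Cost.of_mem hγ)

end Sums

end DMDiv

theorem mainTheorem3 :
    ∃ K : ℕ, ∀ (V : Type*) [Fintype V] [DecidableEq V] [Nonempty V]
      (S : V → Type*) [∀ v, Fintype (S v)] [∀ v, Nonempty (S v)]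
      (r : ℕ) (_ : ∀ v, Fintype.card (S v) ≤ r)
      (GP GQ : SimpleGraph V) (_ : IsChordal GP) (_ : IsChordal GQ)
      (Y Z : Finset V) (_ : Disjoint Y Z)
      (NP NQ : Finset (Finset V)) (_ : IsNPartition GP Z NP) (_ : IsNPartition GQ Z NQ)
      (H : SimpleGraph V) (_ : IsComputationGraph H (setsToCliques NP) (setsToCliques NQ)),
      ∃ prog : Program (InputCell GP GQ S),
        prog.steps ≤ K * (Fintype.card V * r ^ (chordalTreewidth H + 1)) ∧
        ∀ α β : ℝ, (α = 0 ∧ β ≠ 0 ∨ α ≠ 0 ∧ β = 0) →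
          ∀ (P : DecomposableModel GP S) (Q : DecomposableModel GQ S),
            prog.output (inputs α β P Q) = condABDiv α β P.joint Q.joint Y Z := by
  -- Each of the two sums costs `4 * 15 + 74 = 134` units of `|V| * r ^ (ω(H) + 1)`; the remaining
  -- operations are a few dozen.
  refine ⟨300, ?_⟩
  intro V _ _ _ S _ _ r hr GP GQ hGP hGQ Y Z hYZ NP NQ hNP hNQ H hH
  have hr1 : 1 ≤ r := (Fintype.card_pos (α := S (Classical.arbitrary V))).trans_le (hr _)
  let x₀ : ∀ v, S v := Classical.arbitrary _
  let θ := ℝ × ℝ × DecomposableModel GP S × DecomposableModel GQ S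
  let inp : θ → InputCell GP GQ S → ℝ := fun t => inputs t.1 t.2.1 t.2.2.1 t.2.2.2
  let A₀ : Set (θ → ℝ) := Set.range fun i t => inp t i
  -- `α + β` is the nonzero one of the two parameters, obtained without branching.
  let γ : θ → ℝ := fun t => t.1 + t.2.1
  let A : Set (θ → ℝ) := A₀ ∪ {γ}
  have hα : (fun t : θ => t.1) ∈ A₀ := ⟨.alpha, rfl⟩
  have hβ : (fun t : θ => t.2.1) ∈ A₀ := ⟨.beta, rfl⟩
  have hcγ : Cost inp A₀ 1 {γ} := (Cost.of_mem hα).add (Cost.of_mem hβ)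
  have hP : ∀ C x, (fun t : θ => t.2.2.1.cpt C x) ∈ A := fun C x => .inl ⟨.cptP C x, rfl⟩
  have hQ : ∀ C x, (fun t : θ => t.2.2.2.cpt C x) ∈ A := fun C x => .inl ⟨.cptQ C x, rfl⟩
  have hγA : γ ∈ A := .inr rfl
  have hcP := Cost.sumOut_factors (inp := inp) (c := 15) hr hr1 hGP hGQ (Y := Y) hNP hNQ hH hP hQ
    (h := fun t m j => weighted (m * localPower (γ t) m j) (Real.log (localPower (γ t) m j)))
    (h' := fun t m j => weighted 1 (-Real.log (localPower (γ t) m j)))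
    (fun A' f g hA' hf hg => by
      have hw := Cost.localPower (inp := inp) (hA' hγA) hf hg
      refine (Cost.components_intro ?_ ?_ : Cost inp A' (3 + 7) _).mono subset_rfl (by omega)
        subset_rfl
      · simpa only [fst_weighted] using (Cost.of_mem hf).mul hw
      · simpa only [snd_weighted] using ((Cost.of_mem hf).mul hw).mul hw.log)
    (fun A' f g hA' hf hg => by
      have hw := Cost.localPower (inp := inp) (hA' hγA) hf hg
      refine (Cost.components_intro ?_ ?_ : Cost inp A' (1 + 5) _).mono subset_rfl (by omega)
        subset_rfl
      · simpa only [fst_weighted, Rat.cast_one] using Cost.const 1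
      · simpa only [snd_weighted, one_mul] using hw.log.neg) x₀
  have hcQ := Cost.sumOut_factors (inp := inp) (c := 15) hr hr1 hGP hGQ (Y := Y) hNP hNQ hH hP hQ
    (h := fun t m j => weighted m (Real.log (localPower (γ t) m j)))
    (h' := fun t m j => weighted (localPower (γ t) m j) (-Real.log (localPower (γ t) m j)))
    (fun A' f g hA' hf hg => by
      have hw := Cost.localPower (inp := inp) (hA' hγA) hf hg
      refine (Cost.components_intro ?_ ?_ : Cost inp A' (0 + 4) _).mono subset_rfl (by omega)
        subset_rfl
      · simpa only [fst_weighted] using Cost.of_mem hf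
      · simpa only [snd_weighted] using (Cost.of_mem hf).mul hw.log)
    (fun A' f g hA' hf hg => by
      have hw := Cost.localPower (inp := inp) (hA' hγA) hf hg
      refine (Cost.components_intro ?_ ?_ : Cost inp A' (2 + 8) _).mono subset_rfl (by omega)
        subset_rfl
      · simpa only [fst_weighted] using hw
      · simpa only [snd_weighted] using hw.mul hw.log.neg) x₀
  let DP : θ → DualNumber ℝ := fun t => dualSumP Y Z NP NQ (γ t) t.2.2.1 t.2.2.2 x₀
  let DQ : θ → DualNumber ℝ := fun t => dualSumQ Y Z NP NQ (γ t) t.2.2.1 t.2.2.2 x₀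
  have hcost := hcγ.trans (hcP.union hcQ)
  set n := Fintype.card V * r ^ (chordalTreewidth H + 1)
  have hn : 1 ≤ n := Nat.mul_pos Fintype.card_pos (Nat.pow_pos hr1)
  let A₁ : Set (θ → ℝ) := A₀ ∪ ({γ} ∪ (components DP ∪ components DQ))
  have hcγ₁ : Cost inp A₁ 0 {γ} := .of_mem (.inr (.inl rfl))
  have hcα : Cost inp A₁ 0 {fun t => t.1} := .of_mem (.inl hα)
  have hcβ : Cost inp A₁ 0 {fun t => t.2.1} := .of_mem (.inl hβ)
  have hPf : Cost inp A₁ 0 {fun t => (DP t).fst} := .of_mem (.inr (.inr (.inl (.inl rfl))))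
  have hPs : Cost inp A₁ 0 {fun t => (DP t).snd} := .of_mem (.inr (.inr (.inl (.inr rfl))))
  have hQf : Cost inp A₁ 0 {fun t => (DQ t).fst} := .of_mem (.inr (.inr (.inr (.inl rfl))))
  have hQs : Cost inp A₁ 0 {fun t => (DQ t).snd} := .of_mem (.inr (.inr (.inr (.inr rfl))))
  have hc0 : Cost inp A₁ 1 {fun _ => (0 : ℝ)} := by simpa using Cost.const (inp := inp) 0
  have hγγ := hcγ₁.mul hcγ₁
  have hout := ((hcα.div hcγ₁).mul (((hPs.sub hPf).add hQf).div hγγ)).add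
    ((hcβ.div hcγ₁).mul ((((hc0.sub hQs).sub hQf).add hPf).div hγγ))
  obtain ⟨prog, hlen, hprog⟩ := ((hcost.trans hout).mono subset_rfl le_rfl
    Set.subset_union_right).exists_program
  refine ⟨prog, hlen.trans (by omega), fun α β h P Q => ?_⟩
  rw [condABDiv_eq_dualSum hYZ hNP hNQ h P Q x₀]
  exact hprog (α, β, P, Q)
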